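/- Let $n=n_1n_2\cdots n_s$ and let $\mathrm H_n$ be the real space of Hermitian $n\times n$ matrices acting on $\mathbb C^{n_1}\otimes\cdots\otimes\mathbb C^{n_s}$, with inner product $\operatorname{Tr}XY$; let $\mathrm H_{n,+,1}$ be the set of density matrices (positive semidefinite, trace one). Let $\mathcal D$ be either the set of separable states (convex hull of the product states $\rho_1\otimes\cdots\otimes\rho_s$), or the set of PPT states with respect to a collection $\mathcal A$ of sets of parties (the density matrices whose partial transpose on the parties in $A$ is positive semidefinite for every $A\in\mathcal A$; for two parties and $\mathcal A=\{\{1\}\}$ these are the usual PPT states). Let $\partial\mathcal D$ be its boundary relative to its affine hull (which is the space of Hermitian matrices of trace one). For $\rho\in\mathrm H_{n,+,1}$ and $\sigma'\in\mathcal D$ put $S(\rho\|\sigma')=\operatorname{Tr}(\rho\log\rho-\rho\log\sigma')$ (with value $+\infty$ unless $\ker\sigma'\subseteq\ker\rho$, and $0\log 0=0$) and $E_R(\rho)=\inf_{\sigma'\in\mathcal D}S(\rho\|\sigma')$. A state $\sigma\in\mathcal D$ is a closest state (CSS) of $\rho$ if $E_R(\rho)=S(\rho\|\sigma)$. For $\sigma>0$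 let $L_\sigma:\mathrm H_n\to\mathrm H_n$ be given, in an orthonormal eigenbasis of $\sigma$ with eigenvalues $a_1,\dots,a_n$, by $[L_\sigma(\beta)]_{kl}=\beta_{kl}\,\frac{\log a_k-\log a_l}{a_k-a_l}$ (with the quotient read as $1/a_k$ if $a_k=a_l$). It is invertible, $[L_\sigma^{-1}(\beta)]_{kl}=\beta_{kl}\,\frac{a_k-a_l}{\log a_k-\log a_l}$ (quotient read as $a_k$ if $a_k=a_l$). **(a)** Let $0<\sigma\in\partial\mathcal D$. Then $L_\sigma$ is the derivative of the matrix logarithm at $\sigma$: $\frac{d}{dt}\big|_{t=0}\log(\sigma+t\beta)=L_\sigma(\beta)$ for all $\beta\in\mathrm H_n$. Call $\phi\in\mathrm H_n$ a normalized supporting hyperplane of $\mathcal D$ at $\sigma$ if $\operatorname{Tr}(\phi\sigma')\ge\operatorname{Tr}(\phi\sigma)=0$ for all $\sigma'\in\mathcal D$ and $\operatorname{Tr}\phi^2=1$. For each such $\phi$ there is exactly one $x_{\max}>0$ such that $\sigma-x_{\max}L_\sigma^{-1}(\phi)$ is a density matrix with at least one zero eigenvalue, and all the matrices $$\rho(x,\sigma)=\sigma-x\,L_\sigma^{-1}(\phi),\qquad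 0<x\le x_{\max},$$ are density matrices that do not belong to $\mathcal D$. Moreover, for every $\rho\in\mathrm H_{n,+,1}$ with $\rho\neq\sigma$: $\sigma$ is a closest state of $\rho$, i.e. $E_R(\rho)=S(\rho\|\sigma)$, if and only if $\rho=\sigma-xL_\sigma^{-1}(\phi)$ for some normalized supporting hyperplane $\phi$ of $\mathcal D$ at $\sigma$ and some $0<x\le x_{\max}$. **(b)** If $\rho\in\mathrm H_{n,+,1}$ and $\rho>0$, then $\rho$ has exactly one closest state in $\mathcal D$. -/

import Mathlib

open Matrix
open scoped ComplexOrder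

noncomputable section

/-- The computational basis of `ℂ^{d 0} ⊗ ⋯ ⊗ ℂ^{d (s-1)}`: one basis label for each party. -/
abbrev MultiIndex {s : ℕ} (d : Fin s → ℕ) : Type := (i : Fin s) → Fin (d i)

/-- Density matrices: positive semidefinite matrices of trace one. -/
def densityMatrices (n : Type) [Fintype n] : Set (Matrix n n ℂ) :=
  {ρ | ρ.PosSemidef ∧ ρ.trace = 1}

/-- The tensor (Kronecker) product of a family of matrices, one for each party. -/
def tensorMatrix {s : ℕ} {d : Fin s → ℕ} (τ : (i : Fin s) → Matrix (Fin (d i)) (Fin (d i)) ℂ) :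
    Matrix (MultiIndex d) (MultiIndex d) ℂ :=
  Matrix.of fun a b => ∏ i, τ i (a i) (b i)

/-- Separable states: convex combinations of product states. -/
def separableStates {s : ℕ} (d : Fin s → ℕ) : Set (Matrix (MultiIndex d) (MultiIndex d) ℂ) :=
  convexHull ℝ {ρ | ∃ τ : (i : Fin s) → Matrix (Fin (d i)) (Fin (d i)) ℂ,
    (∀ i, τ i ∈ densityMatrices (Fin (d i))) ∧ ρ = tensorMatrix τ}

/-- The partial transpose on the parties in `A`. -/
def partialTranspose {s : ℕ} {d : Fin s → ℕ} (A : Finset (Fin s))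
    (M : Matrix (MultiIndex d) (MultiIndex d) ℂ) : Matrix (MultiIndex d) (MultiIndex d) ℂ :=
  Matrix.of fun a b => M (fun i => if i ∈ A then b i else a i) (fun i => if i ∈ A then a i else b i)

/-- PPT states with respect to a collection `𝒜` of sets of parties: the states all of whose
partial transposes on the sets in `𝒜` are positive semidefinite. For two parties and
`𝒜 = {{0}}` these are the usual PPT states; for several parties `𝒜 = Set.univ` gives the states
that are PPT with respect to every bipartition. -/
def pptStates {s : ℕ} (d : Fin s → ℕ) (𝒜 : Set (Finset (Fin s))) :
    Set (Matrix (MultiIndex d) (MultiIndex d) ℂ) :=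
  {ρ | ρ ∈ densityMatrices (MultiIndex d) ∧ ∀ A ∈ 𝒜, (partialTranspose A ρ).PosSemidef}

section General

variable {n : Type} [Fintype n] [DecidableEq n]

/-- The logarithm of a Hermitian matrix, through the spectral decomposition
(with the value `0` on the kernel). -/
def matrixLog (A : Matrix n n ℂ) : Matrix n n ℂ := cfc Real.log A

open Classical in
/-- Relative entropy `S(ρ‖σ) = Tr (ρ log ρ - ρ log σ)`, which is `+∞` unless the kernel of `σ`
is contained in the kernel of `ρ`. -/
def relEntropy (ρ σ : Matrix n n ℂ) : EReal :=
  if ∀ v : n → ℂ, σ *ᵥ v = 0 → ρ *ᵥ v = 0 then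
    (((ρ * matrixLog ρ - ρ * matrixLog σ).trace.re : ℝ) : EReal)
  else ⊤

/-- The relative entropy of entanglement with respect to the set `D`. -/
def relEntropyOfEntanglement (D : Set (Matrix n n ℂ)) (ρ : Matrix n n ℂ) : EReal :=
  ⨅ σ' ∈ D, relEntropy ρ σ'

/-- `σ` is a closest state of `ρ` in `D`: the infimum defining `E_R(ρ)` is attained at `σ ∈ D`. -/
def IsClosestState (D : Set (Matrix n n ℂ)) (ρ σ : Matrix n n ℂ) : Prop :=
  σ ∈ D ∧ relEntropyOfEntanglement D ρ = relEntropy ρ σ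

/-- The divided difference of `log`, with value `1 / a` on the diagonal. -/
def logDividedDiff (a b : ℝ) : ℝ :=
  if a = b then 1 / a else (Real.log a - Real.log b) / (a - b)

/-- The reciprocal divided difference of `log`, with value `a` on the diagonal. -/
def logDividedDiffRecip (a b : ℝ) : ℝ :=
  if a = b then a else (a - b) / (Real.log a - Real.log b)

/-- In an orthonormal eigenbasis of `σ`, with eigenvalues `a k`, take the entrywise product with
the matrix `g (a k) (a l)`. -/
def eigenHadamard {σ : Matrix n n ℂ} (hσ : σ.IsHermitian) (g : ℝ → ℝ → ℝ) (β : Matrix n n ℂ) :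
    Matrix n n ℂ :=
  (hσ.eigenvectorUnitary : Matrix n n ℂ) *
    ((star (hσ.eigenvectorUnitary : Matrix n n ℂ) * β * (hσ.eigenvectorUnitary : Matrix n n ℂ)) ⊙
      Matrix.of fun k l => ((g (hσ.eigenvalues k) (hσ.eigenvalues l) : ℝ) : ℂ)) *
    star (hσ.eigenvectorUnitary : Matrix n n ℂ)

/-- The operator `L_σ`, the derivative of the matrix logarithm at `σ`: the entrywise product, in an
eigenbasis of `σ`, with the divided differences of `log` at the eigenvalues. -/
def logDirDeriv {σ : Matrix n n ℂ} (hσ : σ.IsHermitian) (β : Matrix n n ℂ) : Matrix n n ℂ :=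
  eigenHadamard hσ logDividedDiff β

/-- The operator `L_σ⁻¹` (the inverse of `L_σ` when `σ` is positive definite). -/
def logDirDerivInv {σ : Matrix n n ℂ} (hσ : σ.IsHermitian) (β : Matrix n n ℂ) : Matrix n n ℂ :=
  eigenHadamard hσ logDividedDiffRecip β

theorem logDividedDiff_mul_recip {a b : ℝ} (ha : 0 < a) (hb : 0 < b) :
    logDividedDiff a b * logDividedDiffRecip a b = 1 := by
  unfold logDividedDiff logDividedDiffRecip
  split_ifs with h
  · field_simp
  · have h1 : a - b ≠ 0 := sub_ne_zero.mpr h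
    have h2 : Real.log a - Real.log b ≠ 0 :=
      sub_ne_zero.mpr fun hl => h (Real.log_injOn_pos ha hb hl)
    field_simp

theorem eigenHadamard_comp {σ : Matrix n n ℂ} (hσ : σ.IsHermitian) (g k : ℝ → ℝ → ℝ)
    (hgk : ∀ i j, g (hσ.eigenvalues i) (hσ.eigenvalues j) *
      k (hσ.eigenvalues i) (hσ.eigenvalues j) = 1) (β : Matrix n n ℂ) :
    eigenHadamard hσ g (eigenHadamard hσ k β) = β := by
  unfold eigenHadamard
  set U : Matrix n n ℂ := (hσ.eigenvectorUnitary : Matrix n n ℂ) with hU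
  have h1 : star U * U = 1 := Unitary.coe_star_mul_self hσ.eigenvectorUnitary
  have h2 : U * star U = 1 := Unitary.coe_mul_star_self hσ.eigenvectorUnitary
  have h3 : ∀ X : Matrix n n ℂ, star U * (U * X * star U) * U = X := by
    intro X
    calc star U * (U * X * star U) * U = (star U * U) * X * (star U * U) := by
          simp only [Matrix.mul_assoc]
      _ = X := by rw [h1]; simp
  have h4 : ∀ X : Matrix n n ℂ, U * (star U * X * U) * star U = X := by
    intro X
    calc U * (star U * X * U) * star U = (U * star U) * X * (U * star U) := by
          simp only [Matrix.mul_assoc]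
      _ = X := by rw [h2]; simp
  rw [h3]
  conv_rhs => rw [← h4 β]
  congr 2
  ext i j
  simp only [Matrix.hadamard_apply, Matrix.of_apply]
  rw [mul_assoc, ← Complex.ofReal_mul, mul_comm (k _ _), hgk, Complex.ofReal_one, mul_one]

theorem logDirDeriv_logDirDerivInv {σ : Matrix n n ℂ} (hσ : σ.PosDef) (β : Matrix n n ℂ) :
    logDirDeriv hσ.isHermitian (logDirDerivInv hσ.isHermitian β) = β :=
  eigenHadamard_comp _ _ _
    (fun i j => logDividedDiff_mul_recip (hσ.eigenvalues_pos i) (hσ.eigenvalues_pos j)) β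

theorem logDirDerivInv_logDirDeriv {σ : Matrix n n ℂ} (hσ : σ.PosDef) (β : Matrix n n ℂ) :
    logDirDerivInv hσ.isHermitian (logDirDeriv hσ.isHermitian β) = β :=
  eigenHadamard_comp _ _ _
    (fun i j => by
      rw [mul_comm]
      exact logDividedDiff_mul_recip (hσ.eigenvalues_pos i) (hσ.eigenvalues_pos j)) β

/-- `φ` is a normalized supporting hyperplane of `D` at `σ`. -/
structure IsNormalizedSupport (D : Set (Matrix n n ℂ)) (σ φ : Matrix n n ℂ) : Prop where
  isHermitian : φ.IsHermitian
  nonneg : ∀ σ' ∈ D, 0 ≤ (φ * σ').trace.re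
  vanish : (φ * σ).trace.re = 0
  normalized : (φ * φ).trace = 1

/-- The matrix `ρ(x, σ) = σ - x L_σ⁻¹(φ)`. -/
def rhoLine {σ : Matrix n n ℂ} (hσ : σ.IsHermitian) (φ : Matrix n n ℂ) (x : ℝ) : Matrix n n ℂ :=
  σ - (x : ℂ) • logDirDerivInv hσ φ

/-- `m` is the end point `x_max > 0`: the matrix `ρ(m, σ)` is a density matrix with at least one
zero eigenvalue. -/
structure IsXMax {σ : Matrix n n ℂ} (hσ : σ.IsHermitian) (φ : Matrix n n ℂ) (m : ℝ) : Prop where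
  pos : 0 < m
  mem : rhoLine hσ φ m ∈ densityMatrices n
  singular : ∃ v : n → ℂ, v ≠ 0 ∧ rhoLine hσ φ m *ᵥ v = 0

/-- All matrices `ρ(x, σ) = σ - x L_σ⁻¹(φ)` with `φ` a normalized supporting hyperplane of `D`
at `σ` and `0 < x ≤ x_max`. -/
def closestFamily (D : Set (Matrix n n ℂ)) {σ : Matrix n n ℂ} (hσ : σ.IsHermitian) :
    Set (Matrix n n ℂ) :=
  {ρ | ∃ (φ : Matrix n n ℂ) (m x : ℝ), IsNormalizedSupport D σ φ ∧ IsXMax hσ φ m ∧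
    0 < x ∧ x ≤ m ∧ ρ = rhoLine hσ φ x}

end General

end

/-!
The proof is convex optimization of `f(τ) = -Tr (ρ log τ)`, which is `S(ρ‖τ)` up to a constant, over
the compact convex set `D`.

*Derivative of the logarithm.* If `u` is an eigenvector of `σ` with eigenvalue `a` and `g_a` is the
divided difference `x ↦ (log x - log a) / (x - a)`, then
`u* (log B - log σ) = u* (B - σ) g_a(B)`. With `B = σ + t β` and continuity of the functional
calculus at `σ`, dividing by `t` yields `L_σ β` in the limit, without any perturbation theory of
eigenvectors (`star_eigenvectorUnitary_mul_log_sub_log`, `tendsto_slope_matrixLog`).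

*Tangent inequality.* Since `log` is operator concave, `log τ ≤ log σ + L_σ (τ - σ)`
(`posSemidef_logDirDeriv_sub_log_sub_log`); paired with `ρ` it extends to singular `τ` of finite
relative entropy (`re_trace_mul_matrixLog_le`). So a positive definite `σ ∈ D` minimizes `f` on `D`
if and only if `Tr (ρ L_σ (τ - σ)) ≤ 0` for all `τ ∈ D`. Because `L_σ` is self-adjoint for the
trace pairing and `L_σ σ = 1`, this says that `L_σ (σ - ρ) = 1 - L_σ ρ` is nonnegative on `D` and
vanishes at `σ`: up to normalization it is a supporting hyperplane `φ`, and solving for `ρ` gives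
`ρ = σ - x L_σ⁻¹ φ` (`mem_closestFamily_of_isClosestState`,
`isClosestState_of_mem_closestFamily`). These matrices lie outside `D` as `Tr (φ ρ) < 0`. The
matrix `L_σ⁻¹ φ` is traceless and nonzero, so the ray leaves the positive semidefinite cone at one
point, which is `x_max` (`exists_pos_singular_posSemidef`).

*Existence and uniqueness for `ρ > 0`.* A bound on `f` keeps the eigenvalues of `τ` away from zero,
so the minimum is taken over a compact set on which `f` is continuous (`exists_isClosestState`).
For two minimizers `σ`, `τ` the tangent inequality becomes an equality, as its defect is positive
semidefinite and has trace zero against `ρ > 0`. Pairing `log τ - log σ = L_σ (τ - σ)` with `σ` gives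
`S(σ‖τ) = 0`, hence `σ = τ` by the equality case of Klein's inequality
(`eq_of_re_trace_mul_log_sub_log_eq_zero`).

Compactness of the set of separable states comes from Carathéodory's theorem; as `D` is closed,
`∂D ⊆ D`.
-/

/-! ### The trace pairing -/

section TracePairing

variable {n : Type} [Fintype n]

theorem Matrix.PosSemidef.exists_eq_conjTranspose_mul_self {A : Matrix n n ℂ}
    (hA : A.PosSemidef) : ∃ C : Matrix n n ℂ, A = Cᴴ * C := by
  classical
  open scoped MatrixOrder in
  exact CStarAlgebra.nonneg_iff_eq_star_mul_self.mp hA.nonneg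

theorem Matrix.PosSemidef.trace_mul_nonneg {A B : Matrix n n ℂ} (hA : A.PosSemidef)
    (hB : B.PosSemidef) : 0 ≤ (A * B).trace := by
  obtain ⟨C, rfl⟩ := hB.exists_eq_conjTranspose_mul_self
  rw [← Matrix.mul_assoc, Matrix.trace_mul_comm, ← Matrix.mul_assoc]
  exact (hA.mul_mul_conjTranspose_same C).trace_nonneg

theorem Matrix.PosSemidef.re_trace_mul_nonneg {A B : Matrix n n ℂ} (hA : A.PosSemidef)
    (hB : B.PosSemidef) : 0 ≤ (A * B).trace.re :=
  (Complex.nonneg_iff.mp (hA.trace_mul_nonneg hB)).1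

theorem Matrix.PosDef.eq_zero_of_re_trace_mul_eq_zero {A B : Matrix n n ℂ} (hA : A.PosDef)
    (hB : B.PosSemidef) (h : (A * B).trace.re = 0) : B = 0 := by
  classical
  have h0 : (A * B).trace = 0 :=
    Complex.ext h (Complex.nonneg_iff.mp (hA.posSemidef.trace_mul_nonneg hB)).2.symm
  obtain ⟨C, rfl⟩ := hB.exists_eq_conjTranspose_mul_self
  rw [← Matrix.mul_assoc, Matrix.trace_mul_comm, ← Matrix.mul_assoc,
    (hA.posSemidef.mul_mul_conjTranspose_same C).trace_eq_zero_iff] at h0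
  have hC : Cᴴ = 0 := by
    refine Matrix.ext_of_mulVec_single fun i => ?_
    rw [Matrix.zero_mulVec]
    by_contra hne
    have h1 := hA.re_dotProduct_pos hne
    set v : n → ℂ := Pi.single i 1
    have h2 : star (Cᴴ *ᵥ v) ⬝ᵥ A *ᵥ (Cᴴ *ᵥ v) = star v ⬝ᵥ (C * A * Cᴴ) *ᵥ v := by
      rw [Matrix.star_mulVec, Matrix.conjTranspose_conjTranspose, ← Matrix.dotProduct_mulVec,
        Matrix.mulVec_mulVec, Matrix.mulVec_mulVec, Matrix.mul_assoc]
    rw [h2, h0] at h1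
    simp at h1
  rw [hC, Matrix.zero_mul]

theorem isClosed_posSemidef : IsClosed {A : Matrix n n ℂ | A.PosSemidef} := by
  simp only [Matrix.posSemidef_iff_dotProduct_mulVec, Set.ofPred_and, Set.ofPred_forall]
  refine IsClosed.inter ?_ (isClosed_iInter fun x => ?_)
  · exact isClosed_eq (by fun_prop) continuous_id
  · exact isClosed_le continuous_const (by fun_prop)

end TracePairing

/-! ### Functional calculus of Hermitian matrices -/

section FunctionalCalculus

variable {n : Type} [Fintype n] [DecidableEq n]

theorem Matrix.IsHermitian.eigenvectorUnitary_mul_star {A : Matrix n n ℂ} (hA : A.IsHermitian) :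
    (hA.eigenvectorUnitary : Matrix n n ℂ) * star (hA.eigenvectorUnitary : Matrix n n ℂ) = 1 :=
  Unitary.coe_mul_star_self _

theorem Matrix.IsHermitian.star_eigenvectorUnitary_mul {A : Matrix n n ℂ} (hA : A.IsHermitian) :
    star (hA.eigenvectorUnitary : Matrix n n ℂ) * (hA.eigenvectorUnitary : Matrix n n ℂ) = 1 :=
  Unitary.coe_star_mul_self _

theorem Matrix.IsHermitian.cfc_eq_conj_diagonal {A : Matrix n n ℂ} (hA : A.IsHermitian)
    (f : ℝ → ℝ) :
    cfc f A = (hA.eigenvectorUnitary : Matrix n n ℂ) *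
      diagonal (fun i => (f (hA.eigenvalues i) : ℂ)) *
        star (hA.eigenvectorUnitary : Matrix n n ℂ) := by
  rw [hA.cfc_eq f, IsHermitian.cfc, Unitary.conjStarAlgAut_apply]
  rfl

theorem Matrix.IsHermitian.eq_conj_diagonal {A : Matrix n n ℂ} (hA : A.IsHermitian) :
    A = (hA.eigenvectorUnitary : Matrix n n ℂ) *
      diagonal (fun i => (hA.eigenvalues i : ℂ)) *
        star (hA.eigenvectorUnitary : Matrix n n ℂ) := by
  conv_lhs => rw [hA.spectral_theorem, Unitary.conjStarAlgAut_apply]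
  rfl

/-- The matrix of `β` in the eigenbasis of `A`. -/
noncomputable def Matrix.IsHermitian.inEigenbasis {A : Matrix n n ℂ} (hA : A.IsHermitian)
    (β : Matrix n n ℂ) : Matrix n n ℂ :=
  star (hA.eigenvectorUnitary : Matrix n n ℂ) * β * (hA.eigenvectorUnitary : Matrix n n ℂ)

theorem Matrix.IsHermitian.conj_inEigenbasis {A : Matrix n n ℂ} (hA : A.IsHermitian)
    (β : Matrix n n ℂ) :
    (hA.eigenvectorUnitary : Matrix n n ℂ) * hA.inEigenbasis β *
      star (hA.eigenvectorUnitary : Matrix n n ℂ) = β := by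
  have h2 := hA.eigenvectorUnitary_mul_star
  simp only [IsHermitian.inEigenbasis, Matrix.mul_assoc, h2, Matrix.mul_one]
  rw [← Matrix.mul_assoc, h2, Matrix.one_mul]

theorem Matrix.IsHermitian.inEigenbasis_conj {A : Matrix n n ℂ} (hA : A.IsHermitian)
    (β : Matrix n n ℂ) :
    hA.inEigenbasis ((hA.eigenvectorUnitary : Matrix n n ℂ) * β *
      star (hA.eigenvectorUnitary : Matrix n n ℂ)) = β := by
  have h2 := hA.star_eigenvectorUnitary_mul
  simp only [IsHermitian.inEigenbasis, Matrix.mul_assoc, h2, Matrix.mul_one]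
  rw [← Matrix.mul_assoc, h2, Matrix.one_mul]

theorem Matrix.IsHermitian.inEigenbasis_self {A : Matrix n n ℂ} (hA : A.IsHermitian) :
    hA.inEigenbasis A = diagonal (fun i => (hA.eigenvalues i : ℂ)) := by
  exact (congrArg hA.inEigenbasis hA.eq_conj_diagonal).trans (hA.inEigenbasis_conj _)

theorem Matrix.IsHermitian.isHermitian_inEigenbasis {A β : Matrix n n ℂ} (hA : A.IsHermitian)
    (hβ : β.IsHermitian) : (hA.inEigenbasis β).IsHermitian :=
  isHermitian_conjTranspose_mul_mul _ hβ

theorem Matrix.IsHermitian.posSemidef_inEigenbasis {A β : Matrix n n ℂ} (hA : A.IsHermitian)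
    (hβ : β.PosSemidef) : (hA.inEigenbasis β).PosSemidef :=
  hβ.conjTranspose_mul_mul_same _

theorem Matrix.IsHermitian.posDef_inEigenbasis {A β : Matrix n n ℂ} (hA : A.IsHermitian)
    (hβ : β.PosDef) : (hA.inEigenbasis β).PosDef := by
  refine (hA.posSemidef_inEigenbasis hβ.posSemidef).posDef_iff_isUnit.mpr ?_
  exact ((Unitary.toUnits (star hA.eigenvectorUnitary)).isUnit.mul hβ.isUnit).mul
    (Unitary.toUnits hA.eigenvectorUnitary).isUnit

theorem Matrix.IsHermitian.trace_mul_conj {A : Matrix n n ℂ} (hA : A.IsHermitian)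
    (α M : Matrix n n ℂ) :
    (α * ((hA.eigenvectorUnitary : Matrix n n ℂ) * M *
      star (hA.eigenvectorUnitary : Matrix n n ℂ))).trace = (hA.inEigenbasis α * M).trace := by
  rw [IsHermitian.inEigenbasis, ← Matrix.mul_assoc, ← Matrix.mul_assoc, Matrix.trace_mul_comm]
  simp only [Matrix.mul_assoc]

theorem Matrix.IsHermitian.re_trace_mul_cfc {A : Matrix n n ℂ} (hA : A.IsHermitian)
    (ρ : Matrix n n ℂ) (f : ℝ → ℝ) :
    (ρ * cfc f A).trace.re = ∑ i, (hA.inEigenbasis ρ i i).re * f (hA.eigenvalues i) := by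
  rw [hA.cfc_eq_conj_diagonal, hA.trace_mul_conj, Matrix.trace, Complex.re_sum]
  refine Finset.sum_congr rfl fun i _ => ?_
  rw [Matrix.diag_apply, Matrix.mul_diagonal, Complex.re_mul_ofReal]

/-- An eigenvector of `A` for the eigenvalue `0` carries no weight of `ρ` if the kernel of `A`
is contained in the kernel of `ρ`. -/
theorem Matrix.IsHermitian.inEigenbasis_diag_eq_zero {A ρ : Matrix n n ℂ} (hA : A.IsHermitian)
    (hker : ∀ v : n → ℂ, A *ᵥ v = 0 → ρ *ᵥ v = 0) {i : n} (hi : hA.eigenvalues i = 0) :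
    hA.inEigenbasis ρ i i = 0 := by
  have h1 : ρ *ᵥ ((hA.eigenvectorUnitary : Matrix n n ℂ) *ᵥ Pi.single i 1) = 0 := by
    apply hker
    rw [hA.eigenvectorUnitary_mulVec, hA.mulVec_eigenvectorBasis, hi, zero_smul]
  have h2 : hA.inEigenbasis ρ *ᵥ Pi.single i 1 = 0 := by
    rw [IsHermitian.inEigenbasis, Matrix.mul_assoc, ← Matrix.mulVec_mulVec, ← Matrix.mulVec_mulVec,
      h1, Matrix.mulVec_zero]
  have h3 := congrFun h2 i
  rwa [Matrix.mulVec_single_one] at h3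

open scoped Matrix.Norms.L2Operator MatrixOrder in
/-- The functional calculus is continuous on positive definite matrices. -/
theorem continuousOn_cfc_posDef {f : ℝ → ℝ} (hf : ContinuousOn f (Set.Ioi 0)) :
    ContinuousOn (fun A : Matrix n n ℂ => cfc f A) {A | A.PosDef} := by
  refine ContinuousOn.cfc_of_mem_nhdsSet (A := Matrix n n ℂ) (s := Set.Ioi 0) f (a := id)
    (t := {A | A.PosDef}) (p := IsSelfAdjoint) ?_ continuousOn_id (fun A hA => hA.1) hf
  refine isOpen_Ioi.mem_nhdsSet.2 ?_
  simp only [Set.iUnion_subset_iff]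
  intro A hA x hx
  rw [id, hA.1.spectrum_real_eq_range_eigenvalues] at hx
  obtain ⟨i, rfl⟩ := hx
  exact hA.eigenvalues_pos i

open scoped Matrix.Norms.L2Operator MatrixOrder in
/-- Hermitian matrices close to a positive definite matrix are positive definite, by upper
hemicontinuity of the spectrum. -/
theorem Matrix.PosDef.eventually_posDef {A : Matrix n n ℂ} (hA : A.PosDef) :
    ∀ᶠ B in nhds A, B.IsHermitian → B.PosDef := by
  have h := (upperHemicontinuous_spectrum ℝ (Matrix n n ℂ)).upperHemicontinuousAt A (Set.Ioi 0) ?_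
  · filter_upwards [h] with B hB hB'
    rw [hB'.posDef_iff_eigenvalues_pos]
    exact fun i => subset_of_mem_nhdsSet hB (hB'.eigenvalues_mem_spectrum_real i)
  · refine isOpen_Ioi.mem_nhdsSet.2 ?_
    intro x hx
    rw [hA.1.spectrum_real_eq_range_eigenvalues] at hx
    obtain ⟨i, rfl⟩ := hx
    exact hA.eigenvalues_pos i

omit [Fintype n] [DecidableEq n] in
theorem isHermitian_add_real_smul {A β : Matrix n n ℂ} (hA : A.IsHermitian)
    (hβ : β.IsHermitian) (t : ℝ) : (A + (t : ℂ) • β).IsHermitian := by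
  refine hA.add ?_
  rw [IsHermitian, conjTranspose_smul, hβ.eq, RCLike.star_def, Complex.conj_ofReal]

theorem Matrix.PosDef.eventually_posDef_add_smul {A β : Matrix n n ℂ} (hA : A.PosDef)
    (hβ : β.IsHermitian) : ∀ᶠ t : ℝ in nhds 0, (A + (t : ℂ) • β).PosDef := by
  have hc : Filter.Tendsto (fun t : ℝ => A + (t : ℂ) • β) (nhds 0) (nhds A) := by
    have : Continuous (fun t : ℝ => A + (t : ℂ) • β) := by fun_prop
    simpa using this.tendsto 0
  filter_upwards [hc.eventually hA.eventually_posDef] with t ht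
  exact ht (isHermitian_add_real_smul hA.1 hβ t)

end FunctionalCalculus

/-! ### Entrywise products in an eigenbasis -/

section EigenHadamard

variable {n : Type} [Fintype n] [DecidableEq n]

theorem logDividedDiff_comm (a b : ℝ) : logDividedDiff a b = logDividedDiff b a := by
  unfold logDividedDiff
  by_cases h : a = b
  · simp [h]
  · rw [if_neg h, if_neg (Ne.symm h), ← neg_sub (Real.log b), ← neg_sub b, neg_div_neg_eq]

theorem logDividedDiffRecip_comm (a b : ℝ) :
    logDividedDiffRecip a b = logDividedDiffRecip b a := by
  unfold logDividedDiffRecip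
  by_cases h : a = b
  · simp [h]
  · rw [if_neg h, if_neg (Ne.symm h), ← neg_sub (Real.log b), ← neg_sub b, neg_div_neg_eq]

theorem logDividedDiffRecip_pos {a b : ℝ} (ha : 0 < a) (hb : 0 < b) :
    0 < logDividedDiffRecip a b := by
  unfold logDividedDiffRecip
  split_ifs with h
  · exact ha
  · rcases lt_or_gt_of_ne h with h | h
    · exact div_pos_of_neg_of_neg (sub_neg.2 h) (sub_neg.2 (Real.log_lt_log ha h))
    · exact div_pos (sub_pos.2 h) (sub_pos.2 (Real.log_lt_log hb h))

theorem log_sub_log_eq_mul_logDividedDiff (a b : ℝ) :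
    Real.log b - Real.log a = (b - a) * logDividedDiff a b := by
  rw [logDividedDiff_comm, logDividedDiff]
  split_ifs with h
  · simp [h]
  · rw [mul_div_cancel₀ _ (sub_ne_zero.2 h)]

theorem continuousOn_logDividedDiff {a : ℝ} (ha : 0 < a) :
    ContinuousOn (logDividedDiff a) (Set.Ioi 0) := by
  have h : logDividedDiff a = dslope Real.log a := by
    funext b
    by_cases hab : b = a
    · subst hab
      rw [dslope_same, Real.deriv_log, logDividedDiff, if_pos rfl, one_div]
    · rw [dslope_of_ne _ hab, slope_def_field, logDividedDiff_comm, logDividedDiff, if_neg hab]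
  rw [h, continuousOn_dslope (Ioi_mem_nhds ha)]
  exact ⟨Real.continuousOn_log.mono fun x hx => (Set.mem_Ioi.1 hx).ne',
    Real.differentiableAt_log ha.ne'⟩

variable {σ : Matrix n n ℂ} (hσ : σ.IsHermitian) (g : ℝ → ℝ → ℝ)

theorem eigenHadamard_eq (β : Matrix n n ℂ) :
    eigenHadamard hσ g β = (hσ.eigenvectorUnitary : Matrix n n ℂ) *
      (hσ.inEigenbasis β ⊙
        Matrix.of fun k l => ((g (hσ.eigenvalues k) (hσ.eigenvalues l) : ℝ) : ℂ)) *
      star (hσ.eigenvectorUnitary : Matrix n n ℂ) := rfl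

theorem eigenHadamard_sub (α β : Matrix n n ℂ) :
    eigenHadamard hσ g (α - β) = eigenHadamard hσ g α - eigenHadamard hσ g β := by
  have h : ∀ A B C : Matrix n n ℂ, (A - B) ⊙ C = A ⊙ C - B ⊙ C := fun A B C => by
    ext i j
    simp [sub_mul]
  simp only [eigenHadamard, Matrix.mul_sub, Matrix.sub_mul, h]

theorem eigenHadamard_smul (c : ℂ) (β : Matrix n n ℂ) :
    eigenHadamard hσ g (c • β) = c • eigenHadamard hσ g β := by
  simp only [eigenHadamard, Matrix.mul_smul, Matrix.smul_mul, Matrix.smul_hadamard]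

theorem isHermitian_eigenHadamard (hg : ∀ a b, g a b = g b a) {β : Matrix n n ℂ}
    (hβ : β.IsHermitian) : (eigenHadamard hσ g β).IsHermitian := by
  rw [eigenHadamard_eq]
  refine isHermitian_mul_mul_conjTranspose _ ((hσ.isHermitian_inEigenbasis hβ).hadamard ?_)
  ext k l
  simp [hg]

theorem trace_mul_eigenHadamard (α β : Matrix n n ℂ) :
    (α * eigenHadamard hσ g β).trace = ∑ k, ∑ l, hσ.inEigenbasis α k l *
      (hσ.inEigenbasis β l k * (g (hσ.eigenvalues l) (hσ.eigenvalues k) : ℝ)) := by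
  rw [eigenHadamard_eq, hσ.trace_mul_conj]
  rfl

/-- The entrywise product with a symmetric kernel is self-adjoint for the trace pairing. -/
theorem trace_mul_eigenHadamard_comm (hg : ∀ a b, g a b = g b a) (α β : Matrix n n ℂ) :
    (α * eigenHadamard hσ g β).trace = (eigenHadamard hσ g α * β).trace := by
  rw [Matrix.trace_mul_comm _ β, trace_mul_eigenHadamard, trace_mul_eigenHadamard,
    Finset.sum_comm]
  refine Finset.sum_congr rfl fun k _ => Finset.sum_congr rfl fun l _ => ?_
  rw [hg]
  ring

/-- The entrywise product with a positive kernel is positive definite for the trace pairing. -/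
theorem re_trace_mul_eigenHadamard_pos
    (hg : ∀ k l, 0 < g (hσ.eigenvalues k) (hσ.eigenvalues l)) {β : Matrix n n ℂ}
    (hβ : β.IsHermitian) (h0 : β ≠ 0) : 0 < (β * eigenHadamard hσ g β).trace.re := by
  have hterm : ∀ k l, (hσ.inEigenbasis β k l *
      (hσ.inEigenbasis β l k * (g (hσ.eigenvalues l) (hσ.eigenvalues k) : ℝ))).re =
      Complex.normSq (hσ.inEigenbasis β k l) * g (hσ.eigenvalues l) (hσ.eigenvalues k) := by
    intro k l
    rw [← (hσ.isHermitian_inEigenbasis hβ).apply l k, ← mul_assoc, RCLike.star_def,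
      Complex.mul_conj, ← Complex.ofReal_mul, Complex.ofReal_re]
  have hnn : ∀ k l, 0 ≤ (hσ.inEigenbasis β k l *
      (hσ.inEigenbasis β l k * (g (hσ.eigenvalues l) (hσ.eigenvalues k) : ℝ))).re := by
    intro k l
    rw [hterm]
    exact mul_nonneg (Complex.normSq_nonneg _) (hg _ _).le
  rw [trace_mul_eigenHadamard]
  simp only [Complex.re_sum]
  refine lt_of_le_of_ne (Finset.sum_nonneg fun k _ => Finset.sum_nonneg fun l _ => hnn k l) ?_
  intro hz
  apply h0
  have hM : hσ.inEigenbasis β = 0 := by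
    ext k l
    have h1 := (Finset.sum_eq_zero_iff_of_nonneg
      fun k _ => Finset.sum_nonneg fun l _ => hnn k l).1 hz.symm k (Finset.mem_univ k)
    have h2 := (Finset.sum_eq_zero_iff_of_nonneg fun l _ => hnn k l).1 h1 l (Finset.mem_univ l)
    rw [hterm] at h2
    exact Complex.normSq_eq_zero.1 ((mul_eq_zero.1 h2).resolve_right (hg _ _).ne')
  rw [← hσ.conj_inEigenbasis β, hM, Matrix.mul_zero, Matrix.zero_mul]

theorem logDirDeriv_self {σ : Matrix n n ℂ} (hσ : σ.PosDef) :
    logDirDeriv hσ.isHermitian σ = 1 := by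
  have h : (hσ.isHermitian.inEigenbasis σ ⊙ Matrix.of fun k l =>
      ((logDividedDiff (hσ.isHermitian.eigenvalues k) (hσ.isHermitian.eigenvalues l) : ℝ) : ℂ))
        = 1 := by
    rw [IsHermitian.inEigenbasis_self]
    ext k l
    by_cases hkl : k = l
    · subst hkl
      simp [logDividedDiff, (hσ.eigenvalues_pos k).ne']
    · simp [hkl]
  rw [logDirDeriv, eigenHadamard_eq, h, Matrix.mul_one, IsHermitian.eigenvectorUnitary_mul_star]

theorem logDirDerivInv_one {σ : Matrix n n ℂ} (hσ : σ.PosDef) :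
    logDirDerivInv hσ.isHermitian 1 = σ := by
  rw [← logDirDeriv_self hσ, logDirDerivInv_logDirDeriv hσ]

theorem trace_logDirDerivInv {σ : Matrix n n ℂ} (hσ : σ.PosDef) (φ : Matrix n n ℂ) :
    (logDirDerivInv hσ.isHermitian φ).trace = (φ * σ).trace := by
  have h := trace_mul_eigenHadamard_comm hσ.isHermitian _ logDividedDiffRecip_comm 1 φ
  rw [Matrix.one_mul] at h
  rw [Matrix.trace_mul_comm φ]
  refine h.trans ?_
  congr 2
  exact logDirDerivInv_one hσ

end EigenHadamard

/-! ### The derivative of the matrix logarithm -/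

section LogDerivative

open Filter Topology

variable {n : Type} [Fintype n] [DecidableEq n]

/-- The difference `log B - log A`, row by row in the eigenbasis of `A`: on the eigenvector of `A`
with eigenvalue `a` it acts as `(B - A) * g B`, where `g` is the divided difference of `log`
at `a`. -/
theorem star_eigenvectorUnitary_mul_log_sub_log {A B : Matrix n n ℂ} (hA : A.IsHermitian)
    (hB : B.IsHermitian) (k l : n) :
    (star (hA.eigenvectorUnitary : Matrix n n ℂ) * (matrixLog B - matrixLog A)) k l =
      (star (hA.eigenvectorUnitary : Matrix n n ℂ) * (B - A) *
        cfc (logDividedDiff (hA.eigenvalues k)) B) k l := by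
  set a := hA.eigenvalues k with ha
  set V := star (hA.eigenvectorUnitary : Matrix n n ℂ) with hV
  have hfin : ∀ f : ℝ → ℝ, ContinuousOn f (spectrum ℝ B) := fun f =>
    (Matrix.finite_real_spectrum (A := B)).continuousOn f
  have hsa : IsSelfAdjoint B := hB
  have h1 : matrixLog B - (Real.log a : ℂ) • (1 : Matrix n n ℂ) =
      (B - (a : ℂ) • (1 : Matrix n n ℂ)) * cfc (logDividedDiff a) B := by
    have e1 : cfc (fun x => Real.log x - Real.log a) B =
        matrixLog B - (Real.log a : ℂ) • (1 : Matrix n n ℂ) := by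
      rw [cfc_sub (fun x => Real.log x) (fun _ => Real.log a) B (hfin _) (hfin _),
        cfc_const (Real.log a) B hsa, Algebra.algebraMap_eq_smul_one]
      rfl
    have e2 : cfc (fun x => x - a) B = B - (a : ℂ) • (1 : Matrix n n ℂ) := by
      rw [cfc_sub (fun x => x) (fun _ => a) B (hfin _) (hfin _), cfc_id' ℝ B hsa,
        cfc_const a B hsa, Algebra.algebraMap_eq_smul_one]
      rfl
    rw [← e1, ← e2, ← cfc_mul _ _ B (hfin _) (hfin _)]
    congr 1
    funext x
    exact log_sub_log_eq_mul_logDividedDiff a x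
  have hVA : ∀ f : ℝ → ℝ, V * cfc f A =
      diagonal (fun i => (f (hA.eigenvalues i) : ℂ)) * V := by
    intro f
    rw [hA.cfc_eq_conj_diagonal, ← Matrix.mul_assoc, ← Matrix.mul_assoc,
      hA.star_eigenvectorUnitary_mul, Matrix.one_mul]
  have hVA' : V * A = diagonal (fun i => (hA.eigenvalues i : ℂ)) * V := by
    have h := hVA (fun x => x)
    rwa [cfc_id' ℝ A (show IsSelfAdjoint A from hA)] at h
  have h2 : V * matrixLog B = V * (matrixLog B - (Real.log a : ℂ) • (1 : Matrix n n ℂ)) +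
      (Real.log a : ℂ) • V := by
    rw [Matrix.mul_sub, Matrix.mul_smul, Matrix.mul_one, sub_add_cancel]
  have h3 : V * B = V * (B - (a : ℂ) • (1 : Matrix n n ℂ)) + (a : ℂ) • V := by
    rw [Matrix.mul_sub, Matrix.mul_smul, Matrix.mul_one, sub_add_cancel]
  rw [Matrix.mul_sub, Matrix.mul_sub, Matrix.sub_mul, h2, h1, h3, hVA',
    show matrixLog A = cfc Real.log A from rfl, hVA, Matrix.add_mul, ← Matrix.mul_assoc]
  simp only [Matrix.sub_apply, Matrix.add_apply, Matrix.smul_apply, Matrix.smul_mul,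
    Matrix.mul_assoc, Matrix.diagonal_mul, smul_eq_mul, ← ha]
  ring

theorem tendsto_slope_matrixLog {σ β : Matrix n n ℂ} (hσ : σ.PosDef) (hβ : β.IsHermitian) :
    Tendsto (fun t : ℝ => t⁻¹ • (matrixLog (σ + (t : ℂ) • β) - matrixLog σ)) (𝓝[≠] 0)
      (𝓝 (logDirDeriv hσ.isHermitian β)) := by
  set hH := hσ.isHermitian
  set U := (hH.eigenvectorUnitary : Matrix n n ℂ) with hU
  set N : Matrix n n ℂ → Matrix n n ℂ := fun B => Matrix.of fun k l =>
    (star U * β * cfc (logDividedDiff (hH.eigenvalues k)) B) k l with hN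
  have hlim : logDirDeriv hH β = U * N σ := by
    rw [logDirDeriv, eigenHadamard, Matrix.mul_assoc]
    congr 1
    ext k l
    simp only [hN, Matrix.of_apply]
    rw [hH.cfc_eq_conj_diagonal, ← Matrix.mul_assoc, ← Matrix.mul_assoc,
      Matrix.mul_apply, Matrix.mul_apply]
    refine Finset.sum_congr rfl fun i _ => ?_
    rw [Matrix.hadamard_apply, Matrix.mul_diagonal, Matrix.of_apply]
  have hc : Tendsto (fun t : ℝ => σ + (t : ℂ) • β) (𝓝 0) (𝓝 σ) := by
    have : Continuous (fun t : ℝ => σ + (t : ℂ) • β) := by fun_prop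
    simpa using this.tendsto 0
  have hNlim : Tendsto (fun t : ℝ => U * N (σ + (t : ℂ) • β)) (𝓝 0) (𝓝 (U * N σ)) := by
    refine ((continuous_const.matrix_mul continuous_id).tendsto _).comp ?_
    refine tendsto_pi_nhds.2 fun k => tendsto_pi_nhds.2 fun l => ?_
    have h1 : Tendsto (fun t : ℝ => cfc (logDividedDiff (hH.eigenvalues k)) (σ + (t : ℂ) • β))
        (𝓝 0) (𝓝 (cfc (logDividedDiff (hH.eigenvalues k)) σ)) := by
      refine (continuousOn_cfc_posDef (continuousOn_logDividedDiff
        (hσ.eigenvalues_pos k)) σ hσ).tendsto.comp ?_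
      exact tendsto_nhdsWithin_iff.2 ⟨hc, hσ.eventually_posDef_add_smul hβ⟩
    have hm : Continuous fun X : Matrix n n ℂ => star U * β * X := by fun_prop
    have h2 := (hm.tendsto _).comp h1
    exact tendsto_pi_nhds.1 (tendsto_pi_nhds.1 h2 k) l
  rw [hlim]
  refine (hNlim.mono_left nhdsWithin_le_nhds).congr' ?_
  filter_upwards [self_mem_nhdsWithin] with t ht
  have ht' : t ≠ 0 := ht
  have hB : (σ + (t : ℂ) • β).IsHermitian := isHermitian_add_real_smul hH hβ t
  have h3 : star U * (matrixLog (σ + (t : ℂ) • β) - matrixLog σ) =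
      t • N (σ + (t : ℂ) • β) := by
    ext k l
    rw [star_eigenvectorUnitary_mul_log_sub_log hH hB, add_sub_cancel_left, Matrix.mul_smul,
      Matrix.smul_mul, Matrix.smul_apply, Matrix.smul_apply, smul_eq_mul, Complex.real_smul]
    rfl
  have h4 : matrixLog (σ + (t : ℂ) • β) - matrixLog σ = t • (U * N (σ + (t : ℂ) • β)) := by
    rw [← Matrix.mul_smul, ← h3, ← Matrix.mul_assoc, hH.eigenvectorUnitary_mul_star,
      Matrix.one_mul]
  rw [h4, smul_smul, inv_mul_cancel₀ ht', one_smul]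

theorem hasDerivAt_matrixLog {σ β : Matrix n n ℂ} (hσ : σ.PosDef) (hβ : β.IsHermitian) :
    HasDerivAt (fun t : ℝ => matrixLog (σ + (t : ℂ) • β)) (logDirDeriv hσ.isHermitian β) 0 := by
  open scoped Matrix.Norms.L2Operator in
  rw [hasDerivAt_iff_tendsto_slope_zero]
  simpa using tendsto_slope_matrixLog hσ hβ

theorem tendsto_slope_re_trace_mul_matrixLog (ρ : Matrix n n ℂ) {σ β : Matrix n n ℂ}
    (hσ : σ.PosDef) (hβ : β.IsHermitian) :
    Tendsto (fun t : ℝ => t⁻¹ * ((ρ * matrixLog (σ + (t : ℂ) • β)).trace.re -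
      (ρ * matrixLog σ).trace.re)) (𝓝[≠] 0) (𝓝 (ρ * logDirDeriv hσ.isHermitian β).trace.re) := by
  have hc : Continuous fun X : Matrix n n ℂ => (ρ * X).trace.re := by fun_prop
  refine ((hc.tendsto _).comp (tendsto_slope_matrixLog hσ hβ)).congr fun t => ?_
  simp [Matrix.mul_sub]

open scoped Matrix.Norms.L2Operator MatrixOrder in
theorem matrixLog_concave {A B : Matrix n n ℂ} (hA : A.PosDef) (hB : B.PosDef) {a b : ℝ}
    (ha : 0 ≤ a) (hb : 0 ≤ b) (hab : a + b = 1) :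
    (matrixLog (a • A + b • B) - (a • matrixLog A + b • matrixLog B)).PosSemidef :=
  CFC.concaveOn_log.2 hA.isStrictlyPositive hB.isStrictlyPositive ha hb hab

/-- The operator-concave function `log` lies below its tangent at `σ`. -/
theorem posSemidef_logDirDeriv_sub_log_sub_log {σ τ : Matrix n n ℂ} (hσ : σ.PosDef)
    (hτ : τ.PosDef) :
    (logDirDeriv hσ.isHermitian (τ - σ) - (matrixLog τ - matrixLog σ)).PosSemidef := by
  have h1 := ((tendsto_slope_matrixLog hσ (hτ.1.sub hσ.1)).mono_left
    (nhdsWithin_mono 0 (fun t (ht : t ∈ Set.Ioi (0 : ℝ)) => (Set.mem_Ioi.1 ht).ne'))).sub_const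
      (matrixLog τ - matrixLog σ)
  -- by concavity the slopes of `log` along the segment dominate the slope of the chord
  refine isClosed_posSemidef.mem_of_tendsto h1 ?_
  filter_upwards [Ioo_mem_nhdsGT (zero_lt_one' ℝ)] with t ht
  have h2 := (matrixLog_concave hσ hτ (sub_nonneg.2 ht.2.le) ht.1.le (sub_add_cancel 1 t)).smul
    (inv_nonneg.2 ht.1.le)
  have e1 : (1 - t) • σ + t • τ = σ + (t : ℂ) • (τ - σ) := by
    rw [Complex.coe_smul, sub_smul, one_smul, smul_sub]
    abel
  have e2 : t⁻¹ • (matrixLog (σ + (t : ℂ) • (τ - σ)) - matrixLog σ) -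
      (matrixLog τ - matrixLog σ) = t⁻¹ • (matrixLog ((1 - t) • σ + t • τ) -
        ((1 - t) • matrixLog σ + t • matrixLog τ)) := by
    rw [e1]
    have ht0 : t⁻¹ • (t • (matrixLog τ - matrixLog σ)) = matrixLog τ - matrixLog σ := by
      rw [smul_smul, inv_mul_cancel₀ ht.1.ne', one_smul]
    rw [← ht0, ← smul_sub]
    congr 1
    module
  change PosSemidef _
  rw [e2]
  exact h2

/-- The tangent inequality for `τ ↦ Tr (ρ log τ)`, with `τ` allowed to be singular on the kernel
of `ρ`: it is obtained from `τ + ε` as `ε` tends to zero, the convention `log 0 = 0` being harmless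
because `ρ` has no weight there. -/
theorem re_trace_mul_matrixLog_le {ρ σ τ : Matrix n n ℂ} (hρ : ρ.PosSemidef) (hσ : σ.PosDef)
    (hτ : τ.PosSemidef) (hker : ∀ v : n → ℂ, τ *ᵥ v = 0 → ρ *ᵥ v = 0) :
    (ρ * matrixLog τ).trace.re ≤ (ρ * matrixLog σ).trace.re +
      (ρ * logDirDeriv hσ.isHermitian (τ - σ)).trace.re := by
  have hlog : ∀ ε : ℝ, matrixLog (τ + (ε : ℂ) • (1 : Matrix n n ℂ)) =
      cfc (fun x => Real.log (x + ε)) τ := by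
    intro ε
    have hsa : IsSelfAdjoint τ := hτ.1
    have hfin : ∀ f : ℝ → ℝ, ContinuousOn f (spectrum ℝ τ) := fun f =>
      (Matrix.finite_real_spectrum (A := τ)).continuousOn f
    have e : cfc (fun x => x + ε) τ = τ + (ε : ℂ) • (1 : Matrix n n ℂ) := by
      rw [cfc_add τ (fun x => x) (fun _ => ε) (hfin _) (hfin _), cfc_id' ℝ τ hsa,
        cfc_const ε τ hsa, Algebra.algebraMap_eq_smul_one]
      rfl
    rw [matrixLog, ← e, ← cfc_comp' Real.log (fun x => x + ε) τ
      ((Matrix.finite_real_spectrum (A := τ)).image _ |>.continuousOn _) (hfin _) hsa]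
  have hL : Tendsto (fun ε : ℝ => (ρ * matrixLog (τ + (ε : ℂ) • (1 : Matrix n n ℂ))).trace.re)
      (𝓝[>] 0) (𝓝 (ρ * matrixLog τ).trace.re) := by
    rw [matrixLog, hτ.1.re_trace_mul_cfc]
    simp only [hlog, hτ.1.re_trace_mul_cfc]
    refine tendsto_finsetSum _ fun i _ => ?_
    -- at a zero eigenvalue the term `log ε` is unbounded but has weight zero
    rcases (hτ.eigenvalues_nonneg i).eq_or_lt with h0 | hpos
    · rw [hτ.1.inEigenbasis_diag_eq_zero hker h0.symm]
      simp
    · refine Tendsto.const_mul _ (Tendsto.mono_left ?_ nhdsWithin_le_nhds)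
      have hc : ContinuousAt (fun ε : ℝ => Real.log (hτ.1.eigenvalues i + ε)) 0 := by
        refine ContinuousAt.log (by fun_prop) ?_
        simpa using hpos.ne'
      simpa [ContinuousAt] using hc
  have hR : Tendsto (fun ε : ℝ => (ρ * matrixLog σ).trace.re +
      ((ρ * logDirDeriv hσ.isHermitian (τ - σ)).trace.re +
        ε * (ρ * logDirDeriv hσ.isHermitian 1).trace.re))
      (𝓝[>] 0) (𝓝 ((ρ * matrixLog σ).trace.re +
        (ρ * logDirDeriv hσ.isHermitian (τ - σ)).trace.re)) := by
    refine Tendsto.mono_left ?_ nhdsWithin_le_nhds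
    refine (Continuous.tendsto' (by fun_prop) _ _ (by simp))
  refine le_of_tendsto_of_tendsto hL hR ?_
  filter_upwards [self_mem_nhdsWithin] with ε hε
  have hpd : (τ + (ε : ℂ) • (1 : Matrix n n ℂ)).PosDef := by
    refine PosDef.posSemidef_add hτ (PosDef.one.smul ?_)
    exact Complex.zero_lt_real.2 hε
  have h := hρ.re_trace_mul_nonneg (posSemidef_logDirDeriv_sub_log_sub_log hσ hpd)
  have e : logDirDeriv hσ.isHermitian (τ + (ε : ℂ) • (1 : Matrix n n ℂ) - σ) =
      logDirDeriv hσ.isHermitian (τ - σ) + (ε : ℂ) • logDirDeriv hσ.isHermitian 1 := by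
    have : τ + (ε : ℂ) • (1 : Matrix n n ℂ) - σ = (τ - σ) - (-(ε : ℂ)) • 1 := by
      rw [neg_smul]
      abel
    rw [this, logDirDeriv, eigenHadamard_sub, eigenHadamard_smul, neg_smul, sub_neg_eq_add]
    rfl
  rw [e] at h
  simp only [Matrix.mul_sub, Matrix.mul_add, Matrix.mul_smul, Matrix.trace_sub, Matrix.trace_add,
    Matrix.trace_smul, Complex.sub_re, Complex.add_re, smul_eq_mul, Complex.re_ofReal_mul] at h
  linarith

end LogDerivative

/-! ### The equality case of Klein's inequality -/

section Klein

variable {n : Type} [Fintype n] [DecidableEq n]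

/-- The scalar Klein inequality with its equality case. -/
theorem scalar_klein {a b : ℝ} (ha : 0 < a) (hb : 0 < b) :
    0 ≤ a * Real.log a - a * Real.log b - a + b ∧
      (a * Real.log a - a * Real.log b - a + b = 0 → a = b) := by
  have h1 : Real.log (b / a) = Real.log b - Real.log a := Real.log_div hb.ne' ha.ne'
  have h2 : a * (b / a - 1) = b - a := by field_simp
  constructor
  · have h3 := mul_le_mul_of_nonneg_left (Real.log_le_sub_one_of_pos (div_pos hb ha)) ha.le
    rw [h1, h2] at h3
    linarith
  · intro h
    by_contra hne
    have h3 := mul_lt_mul_of_pos_left (Real.log_lt_sub_one_of_pos (div_pos hb ha)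
      (fun h' => hne ((div_eq_one_iff_eq ha.ne').1 h').symm)) ha
    rw [h1, h2] at h3
    linarith

/-- Positive definite matrices of equal trace and relative entropy zero are equal. -/
theorem eq_of_re_trace_mul_log_sub_log_eq_zero {σ τ : Matrix n n ℂ} (hσ : σ.PosDef)
    (hτ : τ.PosDef) (htr : σ.trace = τ.trace)
    (h : (σ * matrixLog τ).trace.re = (σ * matrixLog σ).trace.re) : σ = τ := by
  set U := (hσ.1.eigenvectorUnitary : Matrix n n ℂ) with hU
  set V := (hτ.1.eigenvectorUnitary : Matrix n n ℂ) with hV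
  set a := hσ.1.eigenvalues with ha
  set b := hτ.1.eigenvalues with hb
  have hUU : U * star U = 1 := hσ.1.eigenvectorUnitary_mul_star
  have hUU' : star U * U = 1 := hσ.1.star_eigenvectorUnitary_mul
  have hVV : V * star V = 1 := hτ.1.eigenvectorUnitary_mul_star
  have hVV' : star V * V = 1 := hτ.1.star_eigenvectorUnitary_mul
  -- `|W i j| ^ 2` is doubly stochastic, and weights the scalar inequality for the pair `(a i, b j)`
  set W := star U * V with hW
  have hWs : star W = star V * U := by rw [hW, star_mul, star_star]
  have hWW : W * star W = 1 := by
    rw [hWs, hW, Matrix.mul_assoc, ← Matrix.mul_assoc V, hVV, Matrix.one_mul, hUU']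
  have hWW' : star W * W = 1 := by
    rw [hWs, hW, Matrix.mul_assoc, ← Matrix.mul_assoc U, hUU, Matrix.one_mul, hVV']
  have hrow : ∀ i, ∑ j, Complex.normSq (W i j) = 1 := by
    intro i
    have h1 := congrFun (congrFun hWW i) i
    rw [Matrix.mul_apply, Matrix.one_apply_eq] at h1
    simp only [Matrix.star_apply, RCLike.star_def, Complex.mul_conj] at h1
    exact_mod_cast h1
  have hcol : ∀ j, ∑ i, Complex.normSq (W i j) = 1 := by
    intro j
    have h1 := congrFun (congrFun hWW' j) j
    rw [Matrix.mul_apply, Matrix.one_apply_eq] at h1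
    simp only [Matrix.star_apply, RCLike.star_def, mul_comm (starRingEnd ℂ _),
      Complex.mul_conj] at h1
    exact_mod_cast h1
  have hσd : σ = U * diagonal (fun i => (a i : ℂ)) * star U := hσ.1.eq_conj_diagonal
  have hτd : τ = V * diagonal (fun i => (b i : ℂ)) * star V := hτ.1.eq_conj_diagonal
  have hdiag : ∀ j, (hτ.1.inEigenbasis σ j j).re = ∑ i, Complex.normSq (W i j) * a i := by
    intro j
    have h1 : hτ.1.inEigenbasis σ = star W * diagonal (fun i => (a i : ℂ)) * W := by
      rw [IsHermitian.inEigenbasis, ← hV, hWs, hW]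
      conv_lhs => rw [hσd]
      simp only [Matrix.mul_assoc]
    rw [h1, Matrix.mul_apply, Complex.re_sum]
    refine Finset.sum_congr rfl fun i _ => ?_
    rw [Matrix.mul_diagonal, Matrix.star_apply, RCLike.star_def, mul_right_comm,
      mul_comm _ (W i j), Complex.mul_conj, ← Complex.ofReal_mul, Complex.ofReal_re]
  have e1 : (σ * matrixLog τ).trace.re =
      ∑ i, ∑ j, Complex.normSq (W i j) * (a i * Real.log (b j)) := by
    rw [matrixLog, hτ.1.re_trace_mul_cfc, Finset.sum_comm]
    refine Finset.sum_congr rfl fun j _ => ?_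
    rw [hdiag, Finset.sum_mul]
    exact Finset.sum_congr rfl fun i _ => by ring
  have e2 : (σ * matrixLog σ).trace.re =
      ∑ i, ∑ j, Complex.normSq (W i j) * (a i * Real.log (a i)) := by
    rw [matrixLog, hσ.1.re_trace_mul_cfc]
    refine Finset.sum_congr rfl fun i _ => ?_
    rw [← Finset.sum_mul, hrow, one_mul, hσ.1.inEigenbasis_self, Matrix.diagonal_apply_eq,
      Complex.ofReal_re]
  have e3 : ∑ i, ∑ j, Complex.normSq (W i j) * a i =
      ∑ i, ∑ j, Complex.normSq (W i j) * b j := by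
    rw [Finset.sum_comm (f := fun i j => Complex.normSq (W i j) * b j)]
    simp only [← Finset.sum_mul, hrow, hcol, one_mul]
    rw [hσ.1.trace_eq_sum_eigenvalues, hτ.1.trace_eq_sum_eigenvalues] at htr
    exact_mod_cast htr
  have hsum : ∑ i, ∑ j, Complex.normSq (W i j) *
      (a i * Real.log (a i) - a i * Real.log (b j) - a i + b j) = 0 := by
    simp only [mul_add, mul_sub, Finset.sum_add_distrib, Finset.sum_sub_distrib]
    rw [← e1, ← e2, e3, h]
    ring
  have hnn : ∀ i j, 0 ≤ Complex.normSq (W i j) *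
      (a i * Real.log (a i) - a i * Real.log (b j) - a i + b j) := fun i j =>
    mul_nonneg (Complex.normSq_nonneg _)
      (scalar_klein (hσ.eigenvalues_pos i) (hτ.eigenvalues_pos j)).1
  -- equality forces `a i = b j` wherever `W i j ≠ 0`, so `W` intertwines the two spectra
  have hcomm : diagonal (fun i => (a i : ℂ)) * W = W * diagonal (fun i => (b i : ℂ)) := by
    ext i j
    rw [Matrix.diagonal_mul, Matrix.mul_diagonal]
    have h1 := (Finset.sum_eq_zero_iff_of_nonneg
      fun i _ => Finset.sum_nonneg fun j _ => hnn i j).1 hsum i (Finset.mem_univ i)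
    have h2 := (Finset.sum_eq_zero_iff_of_nonneg fun j _ => hnn i j).1 h1 j (Finset.mem_univ j)
    rcases mul_eq_zero.1 h2 with h3 | h3
    · rw [Complex.normSq_eq_zero.1 h3, mul_zero, zero_mul]
    · have hab : a i = b j := (scalar_klein (hσ.eigenvalues_pos i) (hτ.eigenvalues_pos j)).2 h3
      rw [hab, mul_comm]
  have hσW : σ = U * (diagonal (fun i => (a i : ℂ)) * W) * star V := by
    conv_lhs => rw [hσd]
    rw [hW]
    simp only [Matrix.mul_assoc, hVV, Matrix.mul_one]
  rw [hσW, hcomm, hW]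
  conv_rhs => rw [hτd]
  rw [← Matrix.mul_assoc, ← Matrix.mul_assoc, hUU, Matrix.one_mul]

end Klein

/-! ### Relative entropy and closest states -/

section ClosestState

open Filter Topology

variable {n : Type} [Fintype n] [DecidableEq n]

omit [DecidableEq n] in
theorem Matrix.PosDef.eq_zero_of_mulVec_eq_zero {σ : Matrix n n ℂ} (hσ : σ.PosDef) {v : n → ℂ}
    (hv : σ *ᵥ v = 0) : v = 0 := by
  by_contra hne
  have h := hσ.re_dotProduct_pos hne
  rw [hv] at h
  simp at h

theorem Matrix.PosSemidef.posDef_of_ker_le {ρ τ : Matrix n n ℂ} (hτ : τ.PosSemidef)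
    (hρ : ρ.PosDef) (hker : ∀ v : n → ℂ, τ *ᵥ v = 0 → ρ *ᵥ v = 0) : τ.PosDef := by
  rw [hτ.1.posDef_iff_eigenvalues_pos]
  intro i
  refine (hτ.eigenvalues_nonneg i).lt_of_ne fun h0 => ?_
  have h1 := (hτ.1.posDef_inEigenbasis hρ).diag_pos (i := i)
  rw [hτ.1.inEigenbasis_diag_eq_zero hker h0.symm] at h1
  exact lt_irrefl _ h1

theorem relEntropy_of_ker_le {ρ σ : Matrix n n ℂ} (h : ∀ v : n → ℂ, σ *ᵥ v = 0 → ρ *ᵥ v = 0) :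
    relEntropy ρ σ =
      (((ρ * matrixLog ρ).trace.re - (ρ * matrixLog σ).trace.re : ℝ) : EReal) := by
  rw [relEntropy, if_pos h, Matrix.trace_sub, Complex.sub_re]

theorem relEntropy_of_posDef (ρ : Matrix n n ℂ) {σ : Matrix n n ℂ} (hσ : σ.PosDef) :
    relEntropy ρ σ =
      (((ρ * matrixLog ρ).trace.re - (ρ * matrixLog σ).trace.re : ℝ) : EReal) := by
  refine relEntropy_of_ker_le fun v hv => ?_
  rw [hσ.eq_zero_of_mulVec_eq_zero hv, Matrix.mulVec_zero]

theorem isClosestState_iff {D : Set (Matrix n n ℂ)} {ρ σ : Matrix n n ℂ} :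
    IsClosestState D ρ σ ↔ σ ∈ D ∧ ∀ τ ∈ D, relEntropy ρ σ ≤ relEntropy ρ τ := by
  refine and_congr_right fun hσ => ⟨fun h τ hτ => ?_, fun h => ?_⟩
  · rw [← h]
    exact iInf₂_le τ hτ
  · exact le_antisymm (iInf₂_le σ hσ) (le_iInf₂ h)

/-- The first-order condition at a positive definite closest state. -/
theorem re_trace_mul_logDirDeriv_nonpos {D : Set (Matrix n n ℂ)} (hconv : Convex ℝ D)
    (hD : D ⊆ densityMatrices n) {ρ σ τ : Matrix n n ℂ} (hσ : σ.PosDef)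
    (h : IsClosestState D ρ σ) (hτ : τ ∈ D) :
    (ρ * logDirDeriv hσ.isHermitian (τ - σ)).trace.re ≤ 0 := by
  rw [isClosestState_iff] at h
  have hβ : (τ - σ).IsHermitian := (hD hτ).1.1.sub hσ.1
  have h1 := (tendsto_slope_re_trace_mul_matrixLog ρ hσ hβ).mono_left
    (nhdsWithin_mono 0 (fun t (ht : t ∈ Set.Ioi (0 : ℝ)) => (Set.mem_Ioi.1 ht).ne'))
  refine le_of_tendsto h1 ?_
  filter_upwards [Ioo_mem_nhdsGT (zero_lt_one' ℝ),
    nhdsWithin_le_nhds (hσ.eventually_posDef_add_smul hβ)] with t ht hpd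
  have hmem : σ + (t : ℂ) • (τ - σ) ∈ D := by
    rw [Complex.coe_smul]
    exact hconv.add_smul_sub_mem h.1 hτ ⟨ht.1.le, ht.2.le⟩
  have h2 := h.2 _ hmem
  rw [relEntropy_of_posDef ρ hσ, relEntropy_of_posDef ρ hpd, EReal.coe_le_coe_iff] at h2
  exact mul_nonpos_of_nonneg_of_nonpos (inv_nonneg.2 ht.1.le) (by linarith)

/-! ### The end point of a ray leaving a positive definite matrix -/

omit [Fintype n] [DecidableEq n] in
theorem posDef_sub_smul_of_lt {σ X : Matrix n n ℂ} (hσ : σ.PosDef) {m x : ℝ} (hx : 0 ≤ x)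
    (hxm : x < m) (hm : (σ - (m : ℂ) • X).PosSemidef) : (σ - (x : ℂ) • X).PosDef := by
  have hm0 : 0 < m := hx.trans_lt hxm
  have h1 : 0 < 1 - x / m := sub_pos.2 ((div_lt_one hm0).2 hxm)
  have e : σ - (x : ℂ) • X =
      ((1 - x / m : ℝ) : ℂ) • σ + ((x / m : ℝ) : ℂ) • (σ - (m : ℂ) • X) := by
    have e' : ((x / m : ℝ) : ℂ) * (m : ℂ) = (x : ℂ) := by
      rw [← Complex.ofReal_mul, div_mul_cancel₀ _ hm0.ne']
    rw [smul_sub, smul_smul, e', Complex.ofReal_sub, Complex.ofReal_one, sub_smul, one_smul]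
    abel
  rw [e]
  exact (hσ.smul (Complex.zero_lt_real.2 h1)).add_posSemidef
    (hm.smul (Complex.zero_le_real.2 (div_nonneg hx hm0.le)))

/-- The ray `σ - x X` with `X` traceless and nonzero leaves the positive semidefinite cone, and
the matrix at which it does so is singular. -/
theorem exists_pos_singular_posSemidef {σ X : Matrix n n ℂ} (hσ : σ.PosDef)
    (hX : X.IsHermitian) (htr : X.trace = 0) (h0 : X ≠ 0) :
    ∃ m : ℝ, 0 < m ∧ (σ - (m : ℂ) • X).PosSemidef ∧
      ∃ v : n → ℂ, v ≠ 0 ∧ (σ - (m : ℂ) • X) *ᵥ v = 0 := by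
  -- otherwise `-X` would be positive semidefinite of trace zero
  obtain ⟨v, hv⟩ : ∃ v : n → ℂ, 0 < (star v ⬝ᵥ X *ᵥ v).re := by
    by_contra! hneg
    have h1 : (-X).PosSemidef := by
      refine posSemidef_iff_dotProduct_mulVec.2 ⟨hX.neg, fun v => ?_⟩
      rw [Matrix.neg_mulVec, dotProduct_neg, Complex.nonneg_iff]
      refine ⟨by simpa using hneg v, ?_⟩
      have := hX.im_star_dotProduct_mulVec_self v
      simpa using this
    have h2 := h1.trace_eq_zero_iff.1 (by rw [Matrix.trace_neg, htr, neg_zero])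
    exact h0 (neg_eq_zero.1 h2)
  set S : Set ℝ := {x | 0 ≤ x ∧ (σ - (x : ℂ) • X).PosSemidef} with hS
  have hbdd : BddAbove S := by
    refine ⟨(star v ⬝ᵥ σ *ᵥ v).re / (star v ⬝ᵥ X *ᵥ v).re, fun x hx => ?_⟩
    rw [le_div_iff₀ hv]
    have h1 := hx.2.re_dotProduct_nonneg v
    simp only [Matrix.sub_mulVec, Matrix.smul_mulVec, dotProduct_sub, dotProduct_smul,
      smul_eq_mul, RCLike.re_eq_complex_re, Complex.sub_re, Complex.re_ofReal_mul] at h1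
    linarith
  have hclosed : IsClosed S := by
    refine isClosed_Ici.inter (isClosed_posSemidef.preimage ?_)
    exact (by fun_prop : Continuous fun x : ℝ => σ - (x : ℂ) • X)
  have hne : S.Nonempty := ⟨0, le_rfl, by simpa using hσ.posSemidef⟩
  obtain ⟨hm0, hm⟩ := hclosed.csSup_mem hne hbdd
  set m := sSup S
  have hsing : ¬ (σ - (m : ℂ) • X).PosDef := by
    intro hpd
    have h1 := (hpd.eventually_posDef_add_smul hX.neg).filter_mono
      (nhdsWithin_le_nhds (s := Set.Ioi 0))
    obtain ⟨t, ht, ht0⟩ := (h1.and self_mem_nhdsWithin).exists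
    have h2 : m + t ∈ S := by
      refine ⟨add_nonneg hm0 (show 0 < t from ht0).le, ?_⟩
      have e : σ - ((m + t : ℝ) : ℂ) • X = σ - (m : ℂ) • X + (t : ℂ) • -X := by
        rw [Complex.ofReal_add]
        module
      rw [e]
      exact ht.posSemidef
    have h3 := le_csSup hbdd h2
    linarith [show 0 < t from ht0]
  refine ⟨m, hm0.lt_of_ne ?_, hm, ?_⟩
  · intro hz
    apply hsing
    rw [← hz]
    simpa using hσ
  · by_contra! hinj
    apply hsing
    -- a positive semidefinite matrix with trivial kernel is positive definite
    refine hm.posDef_of_ker_le PosDef.one fun v hv => ?_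
    by_contra hne'
    exact hinj v (fun h => hne' (by rw [h, Matrix.mulVec_zero])) hv

theorem IsXMax.le_of_posSemidef {σ φ : Matrix n n ℂ} (hσ : σ.PosDef) {m x : ℝ}
    (hm : IsXMax hσ.isHermitian φ m) (hx : (rhoLine hσ.isHermitian φ x).PosSemidef) : x ≤ m := by
  by_contra! hlt
  obtain ⟨v, hv, hv0⟩ := hm.singular
  exact hv ((posDef_sub_smul_of_lt hσ hm.pos.le hlt hx).eq_zero_of_mulVec_eq_zero hv0)

omit [DecidableEq n] in
theorem IsNormalizedSupport.trace_mul_eq_zero {D : Set (Matrix n n ℂ)} {σ φ : Matrix n n ℂ}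
    (h : IsNormalizedSupport D σ φ) (hσ : σ.IsHermitian) : (φ * σ).trace = 0 := by
  refine Complex.ext h.vanish ?_
  have h1 : star (φ * σ).trace = (φ * σ).trace := by
    rw [← Matrix.trace_conjTranspose, Matrix.conjTranspose_mul, h.isHermitian.eq, hσ.eq,
      Matrix.trace_mul_comm]
  exact Complex.conj_eq_iff_im.1 h1

theorem IsNormalizedSupport.ne_zero {D : Set (Matrix n n ℂ)} {σ φ : Matrix n n ℂ}
    (h : IsNormalizedSupport D σ φ) : φ ≠ 0 := by
  rintro rfl
  simpa using h.normalized

theorem IsNormalizedSupport.existsUnique_isXMax {D : Set (Matrix n n ℂ)}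
    {σ φ : Matrix n n ℂ} (h : IsNormalizedSupport D σ φ) (hσ : σ.PosDef) (htr : σ.trace = 1) :
    ∃! m : ℝ, IsXMax hσ.isHermitian φ m := by
  have hX : (logDirDerivInv hσ.isHermitian φ).IsHermitian :=
    isHermitian_eigenHadamard _ _ logDividedDiffRecip_comm h.isHermitian
  have hXtr : (logDirDerivInv hσ.isHermitian φ).trace = 0 := by
    rw [trace_logDirDerivInv hσ, h.trace_mul_eq_zero hσ.1]
  have hX0 : logDirDerivInv hσ.isHermitian φ ≠ 0 := by
    intro h0
    apply h.ne_zero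
    rw [← logDirDeriv_logDirDerivInv hσ φ, h0]
    simp [logDirDeriv, eigenHadamard]
  obtain ⟨m, hm, hpsd, hv⟩ := exists_pos_singular_posSemidef hσ hX hXtr hX0
  have hmax : IsXMax hσ.isHermitian φ m :=
    ⟨hm, ⟨hpsd, by rw [rhoLine, Matrix.trace_sub, Matrix.trace_smul, hXtr, smul_zero, sub_zero,
      htr]⟩, hv⟩
  exact ⟨m, hmax, fun m' hm' => le_antisymm (hmax.le_of_posSemidef hσ hm'.mem.1)
    (hm'.le_of_posSemidef hσ hpsd)⟩

/-! ### The states with a given closest state -/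

theorem closestFamily_subset {D : Set (Matrix n n ℂ)} {σ : Matrix n n ℂ} (hσ : σ.PosDef)
    (htr : σ.trace = 1) : closestFamily D hσ.isHermitian ⊆ densityMatrices n \ D := by
  rintro ρ ⟨φ, m, x, hφ, hm, hx, hxm, rfl⟩
  have hXtr : (logDirDerivInv hσ.isHermitian φ).trace = 0 := by
    rw [trace_logDirDerivInv hσ, hφ.trace_mul_eq_zero hσ.1]
  refine ⟨⟨?_, ?_⟩, fun hmem => ?_⟩
  · rcases hxm.eq_or_lt with rfl | hlt
    · exact hm.mem.1
    · exact (posDef_sub_smul_of_lt hσ hx.le hlt hm.mem.1).posSemidef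
  · rw [rhoLine, Matrix.trace_sub, Matrix.trace_smul, hXtr, smul_zero, sub_zero, htr]
  · have h1 := hφ.nonneg _ hmem
    have h2 : 0 < (φ * logDirDerivInv hσ.isHermitian φ).trace.re :=
      re_trace_mul_eigenHadamard_pos _ _ (fun k l => logDividedDiffRecip_pos
        (hσ.eigenvalues_pos k) (hσ.eigenvalues_pos l)) hφ.isHermitian hφ.ne_zero
    rw [rhoLine, Matrix.mul_sub, Matrix.mul_smul, Matrix.trace_sub, Matrix.trace_smul,
      Complex.sub_re, hφ.vanish, smul_eq_mul, Complex.re_ofReal_mul] at h1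
    nlinarith [mul_pos hx h2]

theorem trace_mul_logDirDeriv_comm {σ : Matrix n n ℂ} (hσ : σ.IsHermitian)
    (α β : Matrix n n ℂ) : (α * logDirDeriv hσ β).trace = (logDirDeriv hσ α * β).trace :=
  trace_mul_eigenHadamard_comm hσ _ logDividedDiff_comm α β

/-- The gradient of `S(ρ‖·)` at the closest state `σ` is, up to normalization, the supporting
hyperplane `L_σ (σ - ρ) = 1 - L_σ ρ`. -/
theorem mem_closestFamily_of_isClosestState {D : Set (Matrix n n ℂ)} (hconv : Convex ℝ D)
    (hD : D ⊆ densityMatrices n) {ρ σ : Matrix n n ℂ} (hσ : σ.PosDef)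
    (hρ : ρ ∈ densityMatrices n) (hne : ρ ≠ σ) (h : IsClosestState D ρ σ) :
    ρ ∈ closestFamily D hσ.isHermitian := by
  have hσD := hD h.1
  set ψ := logDirDeriv hσ.isHermitian (σ - ρ) with hψ
  have hψH : ψ.IsHermitian :=
    isHermitian_eigenHadamard _ _ logDividedDiff_comm (hσ.1.sub hρ.1.1)
  have hψ1 : ψ = 1 - logDirDeriv hσ.isHermitian ρ := by
    rw [hψ, logDirDeriv, eigenHadamard_sub]
    congr 1
    exact logDirDeriv_self hσ
  have hψinv : logDirDerivInv hσ.isHermitian ψ = σ - ρ := logDirDerivInv_logDirDeriv hσ _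
  have hψ0 : ψ ≠ 0 := by
    intro h0
    rw [h0] at hψinv
    apply hne
    refine (sub_eq_zero.1 (hψinv.symm.trans ?_)).symm
    simp [logDirDerivInv, eigenHadamard]
  -- the pairing of `ψ` with a state is the directional derivative of `S(ρ‖·)` at `σ`
  have hpair : ∀ τ ∈ D, (ψ * τ).trace.re =
      -(ρ * logDirDeriv hσ.isHermitian (τ - σ)).trace.re := by
    intro τ hτ
    have e1 : (ρ * logDirDeriv hσ.isHermitian σ).trace = 1 := by
      rw [logDirDeriv_self hσ, Matrix.mul_one, hρ.2]
    have e2 : logDirDeriv hσ.isHermitian (τ - σ) =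
        logDirDeriv hσ.isHermitian τ - logDirDeriv hσ.isHermitian σ := eigenHadamard_sub _ _ _ _
    rw [e2, Matrix.mul_sub, Matrix.trace_sub, e1, trace_mul_logDirDeriv_comm, hψ1,
      Matrix.sub_mul, Matrix.one_mul, Matrix.trace_sub, (hD hτ).2]
    simp
  have hnn : 0 ≤ (ψ * ψ).trace := by
    have := (posSemidef_conjTranspose_mul_self ψ).trace_nonneg
    rwa [hψH.eq] at this
  have hne0 : (ψ * ψ).trace ≠ 0 := by
    intro h0
    apply hψ0
    rw [← Matrix.trace_conjTranspose_mul_self_eq_zero_iff, hψH.eq, h0]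
  obtain ⟨hre, him⟩ := Complex.nonneg_iff.1 hnn
  have htrre : (ψ * ψ).trace = (((ψ * ψ).trace.re : ℝ) : ℂ) := Complex.ext rfl him.symm
  have hpos : 0 < (ψ * ψ).trace.re := by
    refine hre.lt_of_ne fun h0 => hne0 ?_
    rw [htrre, ← h0, Complex.ofReal_zero]
  set c := Real.sqrt (ψ * ψ).trace.re with hc
  have hc0 : 0 < c := Real.sqrt_pos.2 hpos
  have hcc : c * c = (ψ * ψ).trace.re := Real.mul_self_sqrt hre
  have hφre : ∀ τ, (((c⁻¹ : ℝ) : ℂ) • ψ * τ).trace.re = c⁻¹ * (ψ * τ).trace.re := by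
    intro τ
    rw [Matrix.smul_mul, Matrix.trace_smul, smul_eq_mul, Complex.re_ofReal_mul]
  have hφ : IsNormalizedSupport D σ (((c⁻¹ : ℝ) : ℂ) • ψ) := by
    refine ⟨?_, fun τ hτ => ?_, ?_, ?_⟩
    · rw [IsHermitian, conjTranspose_smul, hψH.eq, RCLike.star_def, Complex.conj_ofReal]
    · rw [hφre, hpair τ hτ]
      exact mul_nonneg (inv_nonneg.2 hc0.le)
        (neg_nonneg.2 (re_trace_mul_logDirDeriv_nonpos hconv hD hσ h hτ))
    · rw [hφre, hpair σ h.1, sub_self]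
      simp [logDirDeriv, eigenHadamard]
    · rw [Matrix.smul_mul, Matrix.mul_smul, smul_smul, Matrix.trace_smul, htrre, ← hcc,
        smul_eq_mul, ← Complex.ofReal_mul, ← Complex.ofReal_mul]
      rw [show c⁻¹ * c⁻¹ * (c * c) = 1 by field_simp, Complex.ofReal_one]
  have hline : rhoLine hσ.isHermitian (((c⁻¹ : ℝ) : ℂ) • ψ) c = ρ := by
    have e : logDirDerivInv hσ.isHermitian (((c⁻¹ : ℝ) : ℂ) • ψ) =
        ((c⁻¹ : ℝ) : ℂ) • (σ - ρ) := by
      rw [← hψinv]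
      exact eigenHadamard_smul _ _ _ _
    rw [rhoLine, e, smul_smul, ← Complex.ofReal_mul, mul_inv_cancel₀ hc0.ne', Complex.ofReal_one,
      one_smul, sub_sub_cancel]
  obtain ⟨m, hm, -⟩ := hφ.existsUnique_isXMax hσ hσD.2
  exact ⟨_, m, c, hφ, hm, hc0, hm.le_of_posSemidef hσ (by rw [hline]; exact hρ.1), hline.symm⟩

/-- Conversely, `L_σ ρ = 1 - x φ` turns the tangent inequality at `σ` into
`Tr (ρ log τ) ≤ Tr (ρ log σ) - x Tr (φ τ)`. -/
theorem isClosestState_of_mem_closestFamily {D : Set (Matrix n n ℂ)}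
    (hD : D ⊆ densityMatrices n) {ρ σ : Matrix n n ℂ} (hσ : σ.PosDef) (hσD : σ ∈ D)
    (h : ρ ∈ closestFamily D hσ.isHermitian) : IsClosestState D ρ σ := by
  have hρ := (closestFamily_subset hσ (hD hσD).2 h).1
  obtain ⟨φ, m, x, hφ, -, hx, -, hρx⟩ := h
  rw [isClosestState_iff]
  refine ⟨hσD, fun τ hτ => ?_⟩
  by_cases hker : ∀ v : n → ℂ, τ *ᵥ v = 0 → ρ *ᵥ v = 0
  · rw [relEntropy_of_posDef ρ hσ, relEntropy_of_ker_le hker, EReal.coe_le_coe_iff]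
    have h1 := re_trace_mul_matrixLog_le hρ.1 hσ (hD hτ).1 hker
    have hLρ : logDirDeriv hσ.isHermitian ρ = 1 - (x : ℂ) • φ := by
      rw [hρx, rhoLine, logDirDeriv, eigenHadamard_sub, eigenHadamard_smul]
      congr 1
      · exact logDirDeriv_self hσ
      · exact congrArg _ (logDirDeriv_logDirDerivInv hσ φ)
    have h2 : (ρ * logDirDeriv hσ.isHermitian (τ - σ)).trace.re = -(x * (φ * τ).trace.re) := by
      rw [trace_mul_logDirDeriv_comm, hLρ, Matrix.sub_mul, Matrix.one_mul, Matrix.smul_mul,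
        Matrix.mul_sub, Matrix.trace_sub, Matrix.trace_smul, Matrix.trace_sub, Matrix.trace_sub,
        (hD hτ).2, (hD hσD).2, sub_self, zero_sub, smul_eq_mul, Complex.neg_re,
        Complex.re_ofReal_mul, Complex.sub_re, hφ.vanish, sub_zero]
    have h3 := mul_nonneg hx.le (hφ.nonneg τ hτ)
    linarith
  · rw [relEntropy, relEntropy, if_neg hker]
    exact le_top

/-! ### Existence and uniqueness of the closest state -/

open scoped MatrixOrder in
theorem posSemidef_sub_smul_one_iff {A : Matrix n n ℂ} (hA : A.IsHermitian) (r : ℝ) :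
    (A - (r : ℂ) • (1 : Matrix n n ℂ)).PosSemidef ↔ ∀ i, r ≤ hA.eigenvalues i := by
  have h := algebraMap_le_iff_le_spectrum (R := ℝ) (A := Matrix n n ℂ) (p := IsSelfAdjoint)
    (r := r) (a := A) hA
  rw [hA.spectrum_real_eq_range_eigenvalues, Set.forall_mem_range] at h
  rw [← h, Algebra.algebraMap_eq_smul_one, Complex.coe_smul]
  rfl

theorem eigenvalues_le_one_of_mem_densityMatrices {τ : Matrix n n ℂ}
    (hτ : τ ∈ densityMatrices n) (i : n) : hτ.1.1.eigenvalues i ≤ 1 := by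
  have h1 : ∑ j, hτ.1.1.eigenvalues j = 1 := by
    have h := congrArg Complex.re hτ.2
    rw [hτ.1.1.trace_eq_sum_eigenvalues, Complex.re_sum] at h
    simpa using h
  rw [← h1]
  exact Finset.single_le_sum (fun j _ => hτ.1.eigenvalues_nonneg j) (Finset.mem_univ i)

/-- States on a superlevel set of `τ ↦ Tr (ρ log τ)` with `ρ > 0` are uniformly positive
definite: every eigenvalue `b` of `τ` satisfies `C ≤ r log b` if `r` is a lower bound of `ρ`. -/
theorem exists_pos_forall_posSemidef_sub {ρ : Matrix n n ℂ} (hρ : ρ.PosDef) (C : ℝ) :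
    ∃ δ : ℝ, 0 < δ ∧ ∀ τ ∈ densityMatrices n, τ.PosDef → C ≤ (ρ * matrixLog τ).trace.re →
      (τ - (δ : ℂ) • (1 : Matrix n n ℂ)).PosSemidef := by
  rcases isEmpty_or_nonempty n with hn | hn
  · exact ⟨1, one_pos, fun τ _ _ _ => by
      rw [Subsingleton.elim (τ - _) 0]
      exact PosSemidef.zero⟩
  obtain ⟨i₀, hi₀⟩ := Finite.exists_min hρ.1.eigenvalues
  set r := hρ.1.eigenvalues i₀ with hr
  have hr0 : 0 < r := hρ.eigenvalues_pos i₀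
  have hρr := (posSemidef_sub_smul_one_iff hρ.1 r).2 hi₀
  refine ⟨Real.exp (C / r), Real.exp_pos _, fun τ hτ hpd hC => ?_⟩
  rw [posSemidef_sub_smul_one_iff hτ.1.1]
  intro i
  have hb := hpd.eigenvalues_pos
  have hlog : ∀ j, Real.log (hτ.1.1.eigenvalues j) ≤ 0 := fun j =>
    Real.log_nonpos (hb j).le (eigenvalues_le_one_of_mem_densityMatrices hτ j)
  have hq : ∀ j, r ≤ (hτ.1.1.inEigenbasis ρ j j).re := by
    intro j
    have h1 := (hτ.1.1.posSemidef_inEigenbasis hρr).diag_nonneg (i := j)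
    rw [IsHermitian.inEigenbasis, Matrix.mul_sub, Matrix.sub_mul, Matrix.mul_smul,
      Matrix.smul_mul, Matrix.mul_one, IsHermitian.star_eigenvectorUnitary_mul, Matrix.sub_apply,
      Matrix.smul_apply, Matrix.one_apply_eq, smul_eq_mul, mul_one] at h1
    have h2 := (Complex.nonneg_iff.1 h1).1
    rw [Complex.sub_re, Complex.ofReal_re] at h2
    exact sub_nonneg.1 h2
  rw [matrixLog, hτ.1.1.re_trace_mul_cfc] at hC
  have h1 : ∑ j, (hτ.1.1.inEigenbasis ρ j j).re * Real.log (hτ.1.1.eigenvalues j) ≤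
      (hτ.1.1.inEigenbasis ρ i i).re * Real.log (hτ.1.1.eigenvalues i) := by
    rw [← Finset.add_sum_erase _ _ (Finset.mem_univ i)]
    refine add_le_of_nonpos_right (Finset.sum_nonpos fun j _ => ?_)
    exact mul_nonpos_of_nonneg_of_nonpos (hr0.le.trans (hq j)) (hlog j)
  have h2 := mul_le_mul_of_nonpos_right (hq i) (hlog i)
  rw [← Real.le_log_iff_exp_le (hb i), div_le_iff₀ hr0]
  linarith

/-- On the states bounded below by some `δ > 0` the relative entropy is continuous; all other states
are either singular, with relative entropy `⊤`, or worse than `τ₀`. -/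
theorem exists_isClosestState {D : Set (Matrix n n ℂ)} (hcomp : IsCompact D)
    (hD : D ⊆ densityMatrices n) {ρ τ₀ : Matrix n n ℂ} (hτ₀ : τ₀ ∈ D) (hτ₀pd : τ₀.PosDef)
    (hρ : ρ.PosDef) : ∃ σ, IsClosestState D ρ σ := by
  obtain ⟨δ, hδ, hsub⟩ := exists_pos_forall_posSemidef_sub hρ (ρ * matrixLog τ₀).trace.re
  set K : Set (Matrix n n ℂ) := D ∩ {τ | (τ - (δ : ℂ) • (1 : Matrix n n ℂ)).PosSemidef} with hK
  have hKc : IsCompact K := by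
    refine hcomp.inter_right (isClosed_posSemidef.preimage ?_)
    exact (by fun_prop : Continuous fun τ : Matrix n n ℂ => τ - (δ : ℂ) • (1 : Matrix n n ℂ))
  have hKpd : K ⊆ {τ | τ.PosDef} := by
    rintro τ ⟨-, hτ⟩
    have h1 := PosDef.posSemidef_add hτ
      ((PosDef.one (n := n)).smul (Complex.zero_lt_real.2 hδ))
    rwa [sub_add_cancel] at h1
  have hcont : ContinuousOn (fun τ => (ρ * matrixLog τ).trace.re) K := by
    have hlog : ContinuousOn (fun τ : Matrix n n ℂ => matrixLog τ) K :=
      (continuousOn_cfc_posDef (Real.continuousOn_log.mono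
        fun x hx => (Set.mem_Ioi.1 hx).ne')).mono hKpd
    have hc : Continuous fun X : Matrix n n ℂ => (ρ * X).trace.re := by fun_prop
    exact hc.comp_continuousOn hlog
  have hτ₀K : τ₀ ∈ K := ⟨hτ₀, hsub τ₀ (hD hτ₀) hτ₀pd le_rfl⟩
  obtain ⟨σ, hσK, hσ⟩ := hKc.exists_isMaxOn ⟨τ₀, hτ₀K⟩ hcont
  refine ⟨σ, isClosestState_iff.2 ⟨hσK.1, fun τ hτ => ?_⟩⟩
  by_cases hker : ∀ v : n → ℂ, τ *ᵥ v = 0 → ρ *ᵥ v = 0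
  · rw [relEntropy_of_posDef ρ (hKpd hσK), relEntropy_of_ker_le hker, EReal.coe_le_coe_iff]
    refine sub_le_sub_left ?_ _
    have hpd := (hD hτ).1.posDef_of_ker_le hρ hker
    rcases le_total (ρ * matrixLog τ₀).trace.re (ρ * matrixLog τ).trace.re with h1 | h1
    · exact hσ ⟨hτ, hsub τ (hD hτ) hpd h1⟩
    · exact h1.trans (hσ hτ₀K)
  · rw [relEntropy, relEntropy, if_neg hker]
    exact le_top

theorem IsClosestState.posDef {D : Set (Matrix n n ℂ)} (hD : D ⊆ densityMatrices n)
    {ρ σ τ₀ : Matrix n n ℂ} (hτ₀ : τ₀ ∈ D) (hτ₀pd : τ₀.PosDef) (hρ : ρ.PosDef)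
    (h : IsClosestState D ρ σ) : σ.PosDef := by
  rw [isClosestState_iff] at h
  refine (hD h.1).1.posDef_of_ker_le hρ ?_
  by_contra hker
  have h1 := h.2 τ₀ hτ₀
  rw [relEntropy, if_neg hker, relEntropy_of_posDef ρ hτ₀pd, top_le_iff] at h1
  exact EReal.coe_ne_top _ h1

/-- If `σ` and `τ` both are closest states of `ρ > 0`, the tangent inequality
`log τ ≤ log σ + L_σ (τ - σ)` has to be an equality; paired with `σ` it says that the relative
entropy of `σ` and `τ` vanishes. -/
theorem IsClosestState.unique {D : Set (Matrix n n ℂ)} (hconv : Convex ℝ D)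
    (hD : D ⊆ densityMatrices n) {ρ σ τ : Matrix n n ℂ} (hρ : ρ.PosDef) (hσpd : σ.PosDef)
    (hτpd : τ.PosDef) (hσ : IsClosestState D ρ σ) (hτ : IsClosestState D ρ τ) : σ = τ := by
  have h1 := re_trace_mul_logDirDeriv_nonpos hconv hD hσpd hσ hτ.1
  have h2 : (ρ * matrixLog τ).trace.re = (ρ * matrixLog σ).trace.re := by
    have h3 := hσ.2.symm.trans hτ.2
    rw [relEntropy_of_posDef ρ hσpd, relEntropy_of_posDef ρ hτpd, EReal.coe_eq_coe_iff] at h3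
    linarith
  have hΔ := posSemidef_logDirDeriv_sub_log_sub_log hσpd hτpd
  have h4 := hρ.posSemidef.re_trace_mul_nonneg hΔ
  have h5 : (ρ * (logDirDeriv hσpd.isHermitian (τ - σ) -
      (matrixLog τ - matrixLog σ))).trace.re =
      (ρ * logDirDeriv hσpd.isHermitian (τ - σ)).trace.re := by
    rw [Matrix.mul_sub, Matrix.mul_sub, Matrix.trace_sub, Matrix.trace_sub, Complex.sub_re,
      Complex.sub_re, h2, sub_self, sub_zero]
  have h6 := hρ.eq_zero_of_re_trace_mul_eq_zero hΔ (le_antisymm (h5.trans_le h1) h4)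
  have htr : σ.trace = τ.trace := by rw [(hD hσ.1).2, (hD hτ.1).2]
  refine eq_of_re_trace_mul_log_sub_log_eq_zero hσpd hτpd htr ?_
  have h7 : (σ * logDirDeriv hσpd.isHermitian (τ - σ)).trace = 0 := by
    rw [trace_mul_logDirDeriv_comm, logDirDeriv_self hσpd, Matrix.one_mul, Matrix.trace_sub, htr,
      sub_self]
  rw [sub_eq_zero.1 h6, Matrix.mul_sub, Matrix.trace_sub, sub_eq_zero] at h7
  rw [h7]

end ClosestState

/-! ### Compactness -/

section Compactness

/-- By Carathéodory's theorem the convex hull of `s` is a finite union of images of the compact sets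
`stdSimplex × s ^ k`. -/
theorem IsCompact.isCompact_convexHull_of_finiteDimensional {E : Type*} [AddCommGroup E]
    [Module ℝ E] [TopologicalSpace E] [ContinuousAdd E] [ContinuousSMul ℝ E]
    [FiniteDimensional ℝ E] {s : Set E} (hs : IsCompact s) : IsCompact (convexHull ℝ s) := by
  have h : convexHull ℝ s = ⋃ k ∈ Finset.range (Module.finrank ℝ E + 2),
      (fun p : (Fin k → ℝ) × (Fin k → E) => ∑ i, p.1 i • p.2 i) ''
        (stdSimplex ℝ (Fin k) ×ˢ Set.univ.pi fun _ => s) := by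
    apply Set.Subset.antisymm
    · intro x hx
      obtain ⟨ι, hι, z, w, hz, haff, hw, hw1, hx⟩ := eq_pos_convex_span_of_mem_convexHull hx
      have hcard : Fintype.card ι ≤ Module.finrank ℝ E + 1 :=
        haff.card_le_finrank_succ.trans (Nat.succ_le_succ (Submodule.finrank_le _))
      let e := (Fintype.equivFin ι).symm
      simp only [Set.mem_iUnion]
      refine ⟨Fintype.card ι, Finset.mem_range.2 (by omega), (w ∘ e, z ∘ e), ⟨⟨?_, ?_⟩, ?_⟩, ?_⟩
      · exact fun i => (hw _).le
      · exact (Equiv.sum_comp e w).trans hw1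
      · exact fun i _ => hz ⟨_, rfl⟩
      · exact (Equiv.sum_comp e fun i => w i • z i).trans hx
    · simp only [Set.iUnion_subset_iff]
      rintro k - _ ⟨⟨w, z⟩, ⟨hw, hz⟩, rfl⟩
      exact (convex_convexHull ℝ s).sum_mem (fun i _ => hw.1 i) hw.2
        fun i _ => subset_convexHull ℝ s (hz i (Set.mem_univ i))
  rw [h]
  refine Finset.isCompact_biUnion _ fun k _ => IsCompact.image ?_ (by fun_prop)
  exact (isCompact_stdSimplex ℝ (Fin k)).prod (isCompact_univ_pi fun _ => hs)

variable {n : Type} [Fintype n]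

/-- The density matrices are the image of the Hilbert–Schmidt unit sphere under `C ↦ Cᴴ C`. -/
theorem isCompact_densityMatrices : IsCompact (densityMatrices n) := by
  have himg : densityMatrices n =
      (fun C : Matrix n n ℂ => Cᴴ * C) '' {C | (Cᴴ * C).trace = 1} := by
    ext ρ
    constructor
    · rintro ⟨hρ, htr⟩
      obtain ⟨C, rfl⟩ := hρ.exists_eq_conjTranspose_mul_self
      exact ⟨C, htr, rfl⟩
    · rintro ⟨C, hC, rfl⟩
      exact ⟨posSemidef_conjTranspose_mul_self C, hC⟩
  rw [himg]
  refine IsCompact.image ?_ (by fun_prop)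
  have hbox : IsCompact (Set.univ.pi fun _ : n => Set.univ.pi fun _ : n =>
      Metric.closedBall (0 : ℂ) 1) :=
    isCompact_univ_pi fun _ => isCompact_univ_pi fun _ => isCompact_closedBall _ _
  have hclosed : IsClosed {C : Matrix n n ℂ | (Cᴴ * C).trace = 1} :=
    isClosed_eq (by fun_prop) continuous_const
  refine IsCompact.of_isClosed_subset hbox hclosed fun C hC => ?_
  intro i _ j _
  rw [mem_closedBall_zero_iff]
  have h1 : ∑ l, ∑ k, ‖C k l‖ ^ 2 = 1 := by
    have h := congrArg Complex.re (show (Cᴴ * C).trace = 1 from hC)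
    simp only [Matrix.trace, Matrix.diag_apply, Matrix.mul_apply, Matrix.conjTranspose_apply,
      Complex.re_sum, RCLike.star_def, mul_comm (starRingEnd ℂ _), Complex.mul_conj,
      Complex.ofReal_re, Complex.one_re, Complex.normSq_eq_norm_sq] at h
    exact h
  have h2 : ‖C i j‖ ^ 2 ≤ 1 := by
    rw [← h1]
    refine le_trans ?_ (Finset.single_le_sum (f := fun l => ∑ k, ‖C k l‖ ^ 2)
      (fun l _ => Finset.sum_nonneg fun k _ => sq_nonneg _) (Finset.mem_univ j))
    exact Finset.single_le_sum (f := fun k => ‖C k j‖ ^ 2) (fun k _ => sq_nonneg _)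
      (Finset.mem_univ i)
  exact (sq_le_one_iff₀ (norm_nonneg _)).1 h2

theorem convex_densityMatrices : Convex ℝ (densityMatrices n) := by
  intro ρ hρ σ hσ a b ha hb hab
  refine ⟨(hρ.1.smul ha).add (hσ.1.smul hb), ?_⟩
  rw [Matrix.trace_add, Matrix.trace_smul, Matrix.trace_smul, hρ.2, hσ.2, ← add_smul, hab,
    one_smul]

theorem nonempty_of_mem_densityMatrices {ρ : Matrix n n ℂ} (hρ : ρ ∈ densityMatrices n) :
    Nonempty n := by
  by_contra h
  rw [not_nonempty_iff] at h
  have h1 := hρ.2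
  simp [Matrix.trace] at h1

end Compactness

/-! ### Separable states -/

section Separable

variable {s : ℕ} {d : Fin s → ℕ}

theorem tensorMatrix_mul (τ τ' : (i : Fin s) → Matrix (Fin (d i)) (Fin (d i)) ℂ) :
    tensorMatrix τ * tensorMatrix τ' = tensorMatrix fun i => τ i * τ' i := by
  ext a b
  simp only [tensorMatrix, Matrix.mul_apply, Matrix.of_apply, ← Finset.prod_mul_distrib]
  rw [Finset.prod_univ_sum, Fintype.piFinset_univ]

theorem conjTranspose_tensorMatrix (τ : (i : Fin s) → Matrix (Fin (d i)) (Fin (d i)) ℂ) :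
    (tensorMatrix τ)ᴴ = tensorMatrix fun i => (τ i)ᴴ := by
  ext a b
  simp [tensorMatrix]

theorem trace_tensorMatrix (τ : (i : Fin s) → Matrix (Fin (d i)) (Fin (d i)) ℂ) :
    (tensorMatrix τ).trace = ∏ i, (τ i).trace := by
  simp only [Matrix.trace, Matrix.diag_apply, tensorMatrix, Matrix.of_apply]
  rw [Finset.prod_univ_sum, Fintype.piFinset_univ]

theorem tensorMatrix_mem_densityMatrices {τ : (i : Fin s) → Matrix (Fin (d i)) (Fin (d i)) ℂ}
    (hτ : ∀ i, τ i ∈ densityMatrices (Fin (d i))) :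
    tensorMatrix τ ∈ densityMatrices (MultiIndex d) := by
  refine ⟨?_, ?_⟩
  · choose C hC using fun i => (hτ i).1.exists_eq_conjTranspose_mul_self
    obtain rfl : τ = fun i => (C i)ᴴ * C i := funext hC
    rw [← tensorMatrix_mul, ← conjTranspose_tensorMatrix]
    exact posSemidef_conjTranspose_mul_self _
  · rw [trace_tensorMatrix]
    exact Finset.prod_eq_one fun i _ => (hτ i).2

theorem separableStates_subset : separableStates d ⊆ densityMatrices (MultiIndex d) := by
  refine convexHull_min ?_ convex_densityMatrices
  rintro _ ⟨τ, hτ, rfl⟩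
  exact tensorMatrix_mem_densityMatrices hτ

theorem isCompact_separableStates : IsCompact (separableStates d) := by
  refine IsCompact.isCompact_convexHull_of_finiteDimensional ?_
  have himg : {ρ | ∃ τ : (i : Fin s) → Matrix (Fin (d i)) (Fin (d i)) ℂ,
      (∀ i, τ i ∈ densityMatrices (Fin (d i))) ∧ ρ = tensorMatrix τ} =
      tensorMatrix '' Set.univ.pi fun i => densityMatrices (Fin (d i)) := by
    ext ρ
    constructor
    · rintro ⟨τ, hτ, rfl⟩
      exact ⟨τ, fun i _ => hτ i, rfl⟩
    · rintro ⟨τ, hτ, rfl⟩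
      exact ⟨τ, fun i => hτ i (Set.mem_univ i), rfl⟩
  rw [himg]
  have hpi : IsCompact (Set.univ.pi fun i : Fin s => densityMatrices (Fin (d i))) :=
    isCompact_univ_pi fun i => isCompact_densityMatrices
  refine hpi.image ?_
  refine continuous_pi fun a => continuous_pi fun b => ?_
  change Continuous fun τ : (i : Fin s) → Matrix (Fin (d i)) (Fin (d i)) ℂ =>
    ∏ i, τ i (a i) (b i)
  refine continuous_finsetProd _ fun i _ => Continuous.matrix_elem (A := fun
    τ : (j : Fin s) → Matrix (Fin (d j)) (Fin (d j)) ℂ => τ i) ?_ (a i) (b i)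
  exact continuous_apply i

theorem inv_card_smul_one_mem_densityMatrices {n : Type} [Fintype n] [DecidableEq n]
    [Nonempty n] :
    (((Fintype.card n : ℝ)⁻¹ : ℝ) : ℂ) • (1 : Matrix n n ℂ) ∈ densityMatrices n := by
  refine ⟨PosSemidef.one.smul (Complex.zero_le_real.2 (by positivity)), ?_⟩
  rw [Matrix.trace_smul, Matrix.trace_one, smul_eq_mul, Complex.ofReal_inv,
    Complex.ofReal_natCast]
  exact inv_mul_cancel₀ (Nat.cast_ne_zero.2 Fintype.card_ne_zero)

theorem posDef_inv_card_smul_one {n : Type} [Fintype n] [DecidableEq n] [Nonempty n] :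
    ((((Fintype.card n : ℝ)⁻¹ : ℝ) : ℂ) • (1 : Matrix n n ℂ)).PosDef :=
  PosDef.one.smul (Complex.zero_lt_real.2
    (inv_pos.2 (Nat.cast_pos.2 Fintype.card_pos)))

theorem inv_card_smul_one_mem_separableStates [hne : Nonempty (MultiIndex d)] :
    (((Fintype.card (MultiIndex d) : ℝ)⁻¹ : ℝ) : ℂ) •
      (1 : Matrix (MultiIndex d) (MultiIndex d) ℂ) ∈ separableStates d := by
  have : ∀ i, Nonempty (Fin (d i)) := fun i => hne.map fun a => a i
  refine subset_convexHull ℝ _ ⟨fun i => (((Fintype.card (Fin (d i)) : ℝ)⁻¹ : ℝ) : ℂ) • 1,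
    fun i => inv_card_smul_one_mem_densityMatrices, ?_⟩
  ext a b
  simp only [tensorMatrix, Matrix.smul_apply, Matrix.of_apply, smul_eq_mul,
    Finset.prod_mul_distrib, Matrix.one_apply, Fintype.card_pi]
  congr 1
  · push_cast
    rw [Finset.prod_inv_distrib]
  · rw [Finset.prod_ite_zero]
    simp [funext_iff]

end Separable

/-! ### PPT states -/

section PPT

variable {s : ℕ} {d : Fin s → ℕ}

theorem partialTranspose_one (A : Finset (Fin s)) :
    partialTranspose A (1 : Matrix (MultiIndex d) (MultiIndex d) ℂ) = 1 := by
  ext a b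
  simp only [partialTranspose, Matrix.of_apply, Matrix.one_apply]
  congr 1
  simp only [funext_iff, eq_iff_iff]
  refine forall_congr' fun i => ?_
  split_ifs
  · exact eq_comm
  · rfl

theorem isClosed_pptStates (𝒜 : Set (Finset (Fin s))) : IsClosed (pptStates d 𝒜) := by
  refine isCompact_densityMatrices.isClosed.inter ?_
  have h : {ρ : Matrix (MultiIndex d) (MultiIndex d) ℂ | ∀ A ∈ 𝒜,
      (partialTranspose A ρ).PosSemidef} =
      ⋂ A ∈ 𝒜, partialTranspose A ⁻¹' {ρ | ρ.PosSemidef} := by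
    ext ρ
    simp
  change IsClosed {ρ : Matrix (MultiIndex d) (MultiIndex d) ℂ | ∀ A ∈ 𝒜,
    (partialTranspose A ρ).PosSemidef}
  rw [h]
  refine isClosed_biInter fun A _ => isClosed_posSemidef.preimage ?_
  exact continuous_pi fun a => continuous_pi fun b => continuous_id.matrix_elem _ _

theorem convex_pptStates (𝒜 : Set (Finset (Fin s))) : Convex ℝ (pptStates d 𝒜) := by
  intro ρ hρ σ hσ a b ha hb hab
  exact ⟨convex_densityMatrices hρ.1 hσ.1 ha hb hab, fun A hA =>
    ((hρ.2 A hA).smul ha).add ((hσ.2 A hA).smul hb)⟩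

theorem inv_card_smul_one_mem_pptStates (𝒜 : Set (Finset (Fin s)))
    [Nonempty (MultiIndex d)] :
    (((Fintype.card (MultiIndex d) : ℝ)⁻¹ : ℝ) : ℂ) •
      (1 : Matrix (MultiIndex d) (MultiIndex d) ℂ) ∈ pptStates d 𝒜 := by
  refine ⟨inv_card_smul_one_mem_densityMatrices, fun A _ => ?_⟩
  have h : partialTranspose A ((((Fintype.card (MultiIndex d) : ℝ)⁻¹ : ℝ) : ℂ) •
      (1 : Matrix (MultiIndex d) (MultiIndex d) ℂ)) =
      (((Fintype.card (MultiIndex d) : ℝ)⁻¹ : ℝ) : ℂ) • partialTranspose A 1 := rfl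
  rw [h, partialTranspose_one]
  exact posDef_inv_card_smul_one.posSemidef

end PPT

/-! ### Closest separable and PPT states -/

theorem theorem3 {s : ℕ} (d : Fin s → ℕ) (D : Set (Matrix (MultiIndex d) (MultiIndex d) ℂ))
    (hD : D = separableStates d ∨ ∃ 𝒜 : Set (Finset (Fin s)), D = pptStates d 𝒜) :
    (∀ (σ : Matrix (MultiIndex d) (MultiIndex d) ℂ) (hσ : σ.PosDef), σ ∈ intrinsicFrontier ℝ D →
      (∀ β : Matrix (MultiIndex d) (MultiIndex d) ℂ, β.IsHermitian →
        HasDerivAt (fun t : ℝ => matrixLog (σ + (t : ℂ) • β)) (logDirDeriv hσ.isHermitian β) 0) ∧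
      (∀ φ, IsNormalizedSupport D σ φ → ∃! m : ℝ, IsXMax hσ.isHermitian φ m) ∧
      closestFamily D hσ.isHermitian ⊆ densityMatrices (MultiIndex d) \ D ∧
      ∀ ρ ∈ densityMatrices (MultiIndex d), ρ ≠ σ →
        (IsClosestState D ρ σ ↔ ρ ∈ closestFamily D hσ.isHermitian)) ∧
    (∀ ρ ∈ densityMatrices (MultiIndex d), ρ.PosDef → ∃! σ, IsClosestState D ρ σ) := by
  have hsub : D ⊆ densityMatrices (MultiIndex d) := by
    rcases hD with rfl | ⟨𝒜, rfl⟩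
    exacts [separableStates_subset, fun ρ hρ => hρ.1]
  have hcomp : IsCompact D := by
    rcases hD with rfl | ⟨𝒜, rfl⟩
    exacts [isCompact_separableStates,
      isCompact_densityMatrices.of_isClosed_subset (isClosed_pptStates 𝒜) hsub]
  have hconv : Convex ℝ D := by
    rcases hD with rfl | ⟨𝒜, rfl⟩
    exacts [convex_convexHull ℝ _, convex_pptStates 𝒜]
  refine ⟨fun σ hσ hfr => ?_, fun ρ hρ hρpd => ?_⟩
  · have hσD : σ ∈ D := intrinsicFrontier_subset hcomp.isClosed hfr
    have htr : σ.trace = 1 := (hsub hσD).2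
    exact ⟨fun β hβ => hasDerivAt_matrixLog hσ hβ, fun φ hφ => hφ.existsUnique_isXMax hσ htr,
      closestFamily_subset hσ htr, fun ρ hρ hne =>
        ⟨mem_closestFamily_of_isClosestState hconv hsub hσ hρ hne,
          isClosestState_of_mem_closestFamily hsub hσ hσD⟩⟩
  · have := nonempty_of_mem_densityMatrices hρ
    have hmix : (((Fintype.card (MultiIndex d) : ℝ)⁻¹ : ℝ) : ℂ) •
        (1 : Matrix (MultiIndex d) (MultiIndex d) ℂ) ∈ D := by
      rcases hD with rfl | ⟨𝒜, rfl⟩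
      exacts [inv_card_smul_one_mem_separableStates, inv_card_smul_one_mem_pptStates 𝒜]
    obtain ⟨σ, hσ⟩ := exists_isClosestState hcomp hsub hmix posDef_inv_card_smul_one hρpd
    refine ⟨σ, hσ, fun τ hτ => ?_⟩
    exact hτ.unique hconv hsub hρpd (hτ.posDef hsub hmix posDef_inv_card_smul_one hρpd)
      (hσ.posDef hsub hmix posDef_inv_card_smul_one hρpd) hσ
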